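/- **Theorem (XHX random fields as Wishart hypertoroidal random fields).** *Setting.* Let $H$ be a Hermitian $2^n\times 2^n$ complex matrix that is not a multiple of the identity, with least eigenvalue $\lambda_1$ and mean eigenvalue $\overline\lambda=2^{-n}\operatorname{tr}H$. Put $$\tilde H=\frac{H-\overline\lambda}{\overline\lambda-\lambda_1},\qquad m=\frac{\lVert H-\lambda_1\rVert_*^2}{\lVert H-\overline\lambda\rVert_F^2},$$ where $\lVert\cdot\rVert_*$ is the nuclear norm and $\lVert\cdot\rVert_F$ the Frobenius norm. For natural numbers $p,r$, with $q=pr$, and angles $\theta\in\mathbb R^p$, let $w_i=(\cos\theta_i,\sin\theta_i)^{\mathsf T}$ and $u_\theta=(w_1\otimes\cdots\otimes w_p)^{\otimes r}\in\mathbb R^{2^q}$. The XHX random field is $$F_{\mathrm{XHX}}(\theta)=2^{-n}\,u_\theta^{\mathsf T}X\tilde HX^\dagger u_\theta+1,$$ where $X$ is a $2^q\times 2^n$ matrix of i.i.d. standard complex normal entries ($\mathbb E|X_{ij}|^2=1$). For a natural number $k\ge1$, the Wishart hypertoroidal random field (WHRF) with $k$ degrees of freedom is $F_k(\theta)=k^{-1}u_\theta^{\mathsf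 T}Ju_\theta$, where $J\sim\mathcal{CW}_{2^q}(k,I)$ is a complex Wishart matrix, i.e. $J=GG^\dagger$ with $G$ a $2^q\times k$ matrix of i.i.d. standard complex normal entries. *Real degrees of freedom.* For a real number $\nu$ and a statistic $f(J)$ whose expectation under $\mathcal{CW}_{2^q}(k,I)$, $k=1,2,\dots$, exists and is a polynomial in $k$, the expectation of $f(J)$ with $\nu$ degrees of freedom is the value of that polynomial at $\nu$. With this convention let $F_{\mathrm{WHRF}}(\theta)=m^{-1}u_\theta^{\mathsf T}Ju_\theta$, where $J$ is complex Wishart with $m$ degrees of freedom. 1. (First two moments.) For all $H,p,r$ as above and all angles $\theta,\theta'$, the expectations below exist and $$\mathbb E[F_{\mathrm{XHX}}(\theta)]=\mathbb E[F_{\mathrm{WHRF}}(\theta)],\qquad \mathbb E[F_{\mathrm{XHX}}(\theta)F_{\mathrm{XHX}}(\theta')]=\mathbb E[F_{\mathrm{WHRF}}(\theta)F_{\mathrm{WHRF}}(\theta')].$$ If $m$ is rounded to a nearest natural number $k$ ($|k-m|\le\frac12$), then $\mathbb E[F_k(\theta)]=\mathbb E[F_{\mathrm{XHX}}(\theta)]$,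 and $$\bigl|\mathbb E[F_k(\theta)F_k(\theta')]-\mathbb E[F_{\mathrm{XHX}}(\theta)F_{\mathrm{XHX}}(\theta')]\bigr|\le\frac{2|k-m|}{m^2}.$$ 2. (One-point law.) For every natural $k\ge1$ and every $\theta$, $F_k(\theta)$ has the Gamma law with shape $k$ and scale $k^{-1}$. Accordingly, the law of $F_{\mathrm{WHRF}}(\theta)$ with real degrees of freedom $m$ is taken to be the Gamma law with shape $m$ and scale $m^{-1}$. 3. (Lévy distance.) For every constant $c<1$ there are $\kappa>0$ and $N$, depending only on $c$, such that for all $n\ge N$ and all $H,p,r,\theta$ as above, if the largest eigenvalue of $\tilde H$ is at most $2^{cn}$, then the Lévy distance between the law of $F_{\mathrm{XHX}}(\theta)$ and the law of $F_{\mathrm{WHRF}}(\theta)$ is at most $2^{-\kappa\min(n,\lg m)}$. The same bound holds with $F_{\mathrm{WHRF}}(\theta)$ replaced by $F_k(\theta)$ for any nearest natural number $k$ to $m$. Here $\lg=\log_2$. -/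

import Mathlib

open MeasureTheory ProbabilityTheory Matrix

noncomputable section

/-! ### Spectral data of a Hamiltonian on `n` qubits -/

/-- The nuclear norm (sum of the singular values) of a square complex matrix. -/
def nuclearNorm {κ : Type*} [Fintype κ] [DecidableEq κ] (A : Matrix κ κ ℂ) : ℝ :=
  ∑ i, Real.sqrt ((isHermitian_conjTranspose_mul_self A).eigenvalues i)

/-- The Frobenius norm of a square complex matrix. -/
def frobNorm {κ : Type*} [Fintype κ] (A : Matrix κ κ ℂ) : ℝ :=
  Real.sqrt (∑ i, ∑ j, ‖A i j‖ ^ 2)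

/-- The ground state energy: the least (real) eigenvalue of a Hermitian matrix. -/
def groundEnergy {n : ℕ} (H : Matrix (Fin (2 ^ n)) (Fin (2 ^ n)) ℂ) : ℝ :=
  sInf (spectrum ℝ H)

/-- The mean eigenvalue `2⁻ⁿ tr H`. -/
def meanEigenvalue {n : ℕ} (H : Matrix (Fin (2 ^ n)) (Fin (2 ^ n)) ℂ) : ℝ :=
  H.trace.re / 2 ^ n

/-- `H - a`, the matrix shifted by a real multiple of the identity. -/
def shiftBy {n : ℕ} (H : Matrix (Fin (2 ^ n)) (Fin (2 ^ n)) ℂ) (a : ℝ) :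
    Matrix (Fin (2 ^ n)) (Fin (2 ^ n)) ℂ :=
  H - (a : ℂ) • (1 : Matrix (Fin (2 ^ n)) (Fin (2 ^ n)) ℂ)

/-- The degrees of freedom parameter `m = ‖H - λ₁‖_*² / ‖H - λ̄‖_F²`. -/
def effDOF {n : ℕ} (H : Matrix (Fin (2 ^ n)) (Fin (2 ^ n)) ℂ) : ℝ :=
  nuclearNorm (shiftBy H (groundEnergy H)) ^ 2 / frobNorm (shiftBy H (meanEigenvalue H)) ^ 2

/-- The scaled and shifted Hamiltonian `H̃ = (H - λ̄) / (λ̄ - λ₁)`. -/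
def scaledHam {n : ℕ} (H : Matrix (Fin (2 ^ n)) (Fin (2 ^ n)) ℂ) :
    Matrix (Fin (2 ^ n)) (Fin (2 ^ n)) ℂ :=
  (((meanEigenvalue H - groundEnergy H)⁻¹ : ℝ) : ℂ) • shiftBy H (meanEigenvalue H)

/-! ### Random matrices -/

instance matrixMeasurableSpace {ι κ : Type*} : MeasurableSpace (Matrix ι κ ℂ) :=
  inferInstanceAs (MeasurableSpace (ι → κ → ℂ))

/-- The law of a standard complex normal variable `Z`: independent centred normal real and
imaginary parts of variance `1/2`, so that `𝔼 |Z|² = 1`. -/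
def stdComplexNormal : Measure ℂ :=
  ((gaussianReal 0 (1 / 2)).prod (gaussianReal 0 (1 / 2))).map Complex.measurableEquivRealProd.symm

/-- The law of an `ι × κ` matrix with i.i.d. standard complex normal entries. -/
def iidComplexNormal (ι κ : Type*) [Fintype ι] [Fintype κ] : Measure (Matrix ι κ ℂ) :=
  (Measure.pi fun _ : ι => Measure.pi fun _ : κ => stdComplexNormal : Measure (ι → κ → ℂ))

/-- The complex Wishart law `𝒞𝒲(k, I)` with `k` degrees of freedom and identity scale matrix:
the law of `G Gᴴ`, where `G` is an `ι × k` matrix of i.i.d. standard complex normals. -/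
def complexWishart (ι : Type*) [Fintype ι] (k : ℕ) : Measure (Matrix ι ι ℂ) :=
  (iidComplexNormal ι (Fin k)).map fun G => G * Gᴴ

/-- The statement that the expectation of the statistic `f (J)`, where
`J ∼ 𝒞𝒲(ν, I)` with a *real* number `ν` of degrees of freedom, is formally equal to `v`:
the expectation of `f` over the complex Wishart laws with `k = 1, 2, 3, …` degrees of freedom is a
polynomial in `k`, and `v` is the value of that (necessarily unique) polynomial at `ν`.
If `ν` is a positive integer, this is the true expectation. -/
def HasWishartExpectation {ι : Type*} [Fintype ι] (ν : ℝ) (f : Matrix ι ι ℂ → ℝ) (v : ℝ) : Prop :=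
  ∃ P : Polynomial ℝ,
    (∀ k : ℕ, 1 ≤ k → Integrable f (complexWishart ι k) ∧
      ∫ J, f J ∂(complexWishart ι k) = P.eval (k : ℝ)) ∧
    v = P.eval ν

/-! ### Random fields on the hypertorus -/

/-- The point `(cos t, sin t)` of the circle. -/
def circlePoint (t : ℝ) : Fin 2 → ℝ := ![Real.cos t, Real.sin t]

/-- The vector `w = w₁ ⊗ ⋯ ⊗ w_p ∈ ℝ^(2^p)`, with `w_i = (cos θ_i, sin θ_i)`. -/
def torusPoint {p : ℕ} (θ : Fin p → ℝ) : (Fin p → Fin 2) → ℝ :=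
  fun i => ∏ a, circlePoint (θ a) (i a)

/-- The vector `w ⊗ ⋯ ⊗ w` (`r` factors) in `ℝ^(2^q)`, `q = p r`. -/
def torusTensor {p : ℕ} (r : ℕ) (θ : Fin p → ℝ) : (Fin r → Fin p → Fin 2) → ℝ :=
  fun i => ∏ b, torusPoint θ (i b)

/-- The quadratic form `uᵀ M u` of a Hermitian matrix `M` at a real vector `u` (a real number). -/
def quadForm {ι : Type*} [Fintype ι] (M : Matrix ι ι ℂ) (u : ι → ℝ) : ℝ :=
  (∑ i, ∑ j, (u i : ℂ) * M i j * (u j : ℂ)).re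

/-- The XHX random field `2⁻ⁿ uᵀ X H̃ Xᴴ u + 1` at the point of the hypertorus with angles `θ`,
as a function of the matrix `X`. -/
def xhxField {n p : ℕ} (r : ℕ) (H : Matrix (Fin (2 ^ n)) (Fin (2 ^ n)) ℂ) (θ : Fin p → ℝ)
    (X : Matrix (Fin r → Fin p → Fin 2) (Fin (2 ^ n)) ℂ) : ℝ :=
  ((2 : ℝ) ^ n)⁻¹ * quadForm (X * scaledHam H * Xᴴ) (torusTensor r θ) + 1

/-- The Wishart hypertoroidal random field `ν⁻¹ uᵀ J u` at the point of the hypertorus with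
angles `θ`, as a function of the matrix `J`. -/
def whrfField {p : ℕ} (r : ℕ) (ν : ℝ) (θ : Fin p → ℝ)
    (J : Matrix (Fin r → Fin p → Fin 2) (Fin r → Fin p → Fin 2) ℂ) : ℝ :=
  ν⁻¹ * quadForm J (torusTensor r θ)

/-- The law of the XHX random field at the point with angles `θ`. -/
def xhxLaw {n p : ℕ} (r : ℕ) (H : Matrix (Fin (2 ^ n)) (Fin (2 ^ n)) ℂ) (θ : Fin p → ℝ) :
    Measure ℝ :=
  (iidComplexNormal (Fin r → Fin p → Fin 2) (Fin (2 ^ n))).map (xhxField r H θ)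

/-- The law, at the point with angles `θ`, of the WHRF with a natural number `k` of degrees of
freedom. -/
def whrfLaw {p : ℕ} (r k : ℕ) (θ : Fin p → ℝ) : Measure ℝ :=
  (complexWishart (Fin r → Fin p → Fin 2) k).map (whrfField r (k : ℝ) θ)

/-- The formal one-point law of the WHRF with a real number `ν > 0` of degrees of freedom:
the Gamma law with shape `ν` and scale `ν⁻¹` (that is, with rate `ν`). -/
def whrfFormalLaw (ν : ℝ) : Measure ℝ := gammaMeasure ν ν

/-- The Lévy distance of two probability measures on the real line. -/
def levyDist (μ ν : Measure ℝ) : ℝ :=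
  sInf {ε : ℝ | 0 < ε ∧ ∀ x : ℝ, cdf μ (x - ε) - ε ≤ cdf ν x ∧ cdf ν x ≤ cdf μ (x + ε) + ε}

end

/-! ### Integrals against Gamma laws -/

/-! Both fields are quadratic forms `uᵀ X B Xᴴ u` in a complex Gaussian matrix, with `B = H̃` for
XHX and `B = 1` of size `k` for Wishart. Wick's formula up to fourth order
(`integral_entryForm_mul`) gives mean `|u|² tr B` and mixed moment `|u|²|v|² (tr B)² + (u·v)²
‖B‖_F²`. The vectors `u` are unit and `H̃` is traceless, so XHX has mixed moment `1 + (u·v)² ‖H̃‖_F²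
/ 4ⁿ`. Since `H - λ₁` is positive semidefinite, its nuclear norm is its trace, whence `m = 4ⁿ /
‖H̃‖_F²` (`effDOF_eq`) and the covariance is `(u·v)² / m`. The Wishart mixed moment is `ν⁻² (k² +
(u·v)² k)`, a polynomial in `k` with the same value at `k = ν = m`.

For the one-point law, contracting `G` with a unit vector leaves `k` i.i.d. standard complex
normals, whose squared moduli are exponential; characteristic functions identify their average as a
Gamma variable.

The Lévy bound needs no finer comparison of the laws. Each has mean 1 and variance at most `2/m`, so
Chebyshev puts both close to the point mass at 1, at distance at most `2 m^(-1/3)` from each other.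
Once `m ≥ 64` this is at most `m^(-1/6)`. The bound on the largest eigenvalue serves to force `m ≥
64` for large `n` (`rpow_le_two_mul_effDOF`). -/

theorem integrableOn_pow_mul_cexp_neg_mul (k : ℕ) {b : ℂ} (hb : 0 < b.re) :
    IntegrableOn (fun x : ℝ => (x : ℂ) ^ k * Complex.exp (-(b * x))) (Set.Ioi 0) := by
  have h := integrableOn_rpow_mul_exp_neg_mul_rpow (p := 1) (s := k) (b := b.re)
    (by have := k.cast_nonneg (α := ℝ); linarith) one_pos hb
  refine Integrable.mono' h (by fun_prop) ?_
  filter_upwards [ae_restrict_mem measurableSet_Ioi] with x hx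
  have hx : 0 < x := hx
  simp [Complex.norm_exp, abs_of_pos hx]

/-- Integration by parts, by induction on `k`. The rate is complex because `b = r - it` occurs in
the characteristic function of a Gamma law. -/
theorem integral_pow_mul_cexp_neg_mul_Ioi (k : ℕ) {b : ℂ} (hb : 0 < b.re) :
    ∫ x in Set.Ioi (0 : ℝ), (x : ℂ) ^ k * Complex.exp (-(b * x)) = k.factorial / b ^ (k + 1) := by
  have hb0 : b ≠ 0 := by rintro rfl; simp at hb
  have hexp : ∀ x : ℝ, HasDerivAt (fun x : ℝ => Complex.exp (-(b * x)))
      (Complex.exp (-(b * x)) * -(b * 1)) x := fun x =>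
    (((hasDerivAt_id (x : ℝ)).ofReal_comp.const_mul b).neg).cexp
  have hlim : ∀ j : ℕ, Filter.Tendsto (fun x : ℝ => (x : ℂ) ^ j * Complex.exp (-(b * x)))
      Filter.atTop (nhds 0) := by
    intro j
    rw [tendsto_zero_iff_norm_tendsto_zero]
    have h := tendsto_rpow_mul_exp_neg_mul_atTop_nhds_zero j b.re hb
    refine h.congr' ?_
    filter_upwards [Filter.eventually_gt_atTop 0] with x hx
    simp [Complex.norm_exp, abs_of_pos hx]
  induction k with
  | zero =>
    have hd : ∀ x ∈ Set.Ici (0 : ℝ), HasDerivAt (fun x : ℝ => -b⁻¹ * Complex.exp (-(b * x)))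
        ((x : ℂ) ^ 0 * Complex.exp (-(b * x))) x := by
      intro x _
      refine ((hexp x).const_mul (-b⁻¹)).congr_deriv ?_
      field_simp
    rw [integral_Ioi_of_hasDerivAt_of_tendsto' hd (integrableOn_pow_mul_cexp_neg_mul 0 hb)
      (by simpa using (hlim 0).const_mul (-b⁻¹))]
    simp
  | succ k ih =>
    have hi := integrableOn_pow_mul_cexp_neg_mul k hb
    have hi' := integrableOn_pow_mul_cexp_neg_mul (k + 1) hb
    have hd : ∀ x ∈ Set.Ici (0 : ℝ),
        HasDerivAt (fun x : ℝ => (x : ℂ) ^ (k + 1) * Complex.exp (-(b * x)))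
        (((k : ℂ) + 1) * ((x : ℂ) ^ k * Complex.exp (-(b * x))) -
          b * ((x : ℂ) ^ (k + 1) * Complex.exp (-(b * x)))) x := by
      intro x _
      have hp : HasDerivAt (fun x : ℝ => (x : ℂ) ^ (k + 1)) (((k + 1 : ℕ) : ℂ) * (x : ℂ) ^ k) x :=
        ((hasDerivAt_id (x : ℝ)).ofReal_comp.pow (k + 1)).congr_deriv (by simp)
      refine (hp.mul (hexp x)).congr_deriv ?_
      push_cast
      ring
    have h0 := integral_Ioi_of_hasDerivAt_of_tendsto' hd
      ((hi.const_mul _).sub (hi'.const_mul _)) (hlim (k + 1))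
    rw [integral_sub (hi.const_mul _) (hi'.const_mul _), integral_const_mul, integral_const_mul,
      ih] at h0
    simp only [Complex.ofReal_zero, ne_eq, Nat.add_eq_zero_iff, one_ne_zero, and_false,
      not_false_eq_true, zero_pow, zero_mul, sub_zero] at h0
    rw [Nat.factorial_succ, Nat.cast_mul, pow_succ b (k + 1), eq_div_iff (by positivity)]
    rw [sub_eq_zero] at h0
    push_cast
    field_simp at h0
    linear_combination -h0

theorem integral_gammaMeasure {E : Type*} [NormedAddCommGroup E] [NormedSpace ℝ E] {a r : ℝ}
    (ha : 0 < a) (hr : 0 < r) (f : ℝ → E) :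
    ∫ x, f x ∂(gammaMeasure a r) =
      ∫ x in Set.Ioi 0, (r ^ a / Real.Gamma a * x ^ (a - 1) * Real.exp (-(r * x))) • f x := by
  have hm : Measurable (gammaPDF a r) := by unfold gammaPDF; fun_prop
  rw [gammaMeasure, integral_withDensity_eq_integral_toReal_smul hm
    (ae_of_all _ fun x => by simp [gammaPDF]), ← integral_Ici_eq_integral_Ioi,
    ← integral_indicator measurableSet_Ici]
  congr 1 with x
  by_cases hx : 0 ≤ x
  · rw [Set.indicator_of_mem (by exact hx), gammaPDF,
      ENNReal.toReal_ofReal (gammaPDFReal_nonneg ha hr x), gammaPDFReal, if_pos hx]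
  · rw [Set.indicator_of_notMem (by exact hx), gammaPDF,
      ENNReal.toReal_ofReal (gammaPDFReal_nonneg ha hr x), gammaPDFReal, if_neg hx, zero_smul]

theorem integral_pow_gammaMeasure {a r : ℝ} (ha : 0 < a) (hr : 0 < r) (j : ℕ) :
    ∫ x, x ^ j ∂(gammaMeasure a r) = Real.Gamma (a + j) / (Real.Gamma a * r ^ j) := by
  have haj : 0 < a + j := by positivity
  rw [integral_gammaMeasure ha hr]
  have h : ∀ x ∈ Set.Ioi (0 : ℝ),
      (r ^ a / Real.Gamma a * x ^ (a - 1) * Real.exp (-(r * x))) • x ^ j =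
      r ^ a / Real.Gamma a * (x ^ (a + j - 1) * Real.exp (-(r * x))) := by
    intro x hx
    have hx : 0 < x := hx
    rw [show a + j - 1 = (a - 1) + (j : ℕ) by ring, Real.rpow_add_natCast hx.ne', smul_eq_mul]
    ring
  rw [setIntegral_congr_fun measurableSet_Ioi h, integral_const_mul,
    Real.integral_rpow_mul_exp_neg_mul_Ioi haj hr, Real.div_rpow zero_le_one hr.le,
    Real.rpow_add_natCast hr.ne', Real.one_rpow]
  have := (Real.rpow_pos_of_pos hr a).ne'
  have := (Real.Gamma_pos_of_pos ha).ne'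
  field_simp

theorem integrable_pow_gammaMeasure {a r : ℝ} (ha : 0 < a) (hr : 0 < r) (j : ℕ) :
    Integrable (fun x => x ^ j) (gammaMeasure a r) := by
  by_contra h
  have h1 := integral_pow_gammaMeasure ha hr j
  -- A non-integrable function has integral 0 by convention, whereas the moment formula gives a
  -- positive number.
  rw [integral_undef h] at h1
  have : 0 < Real.Gamma (a + j) / (Real.Gamma a * r ^ j) :=
    div_pos (Real.Gamma_pos_of_pos (by positivity))
      (mul_pos (Real.Gamma_pos_of_pos ha) (by positivity))
  linarith

theorem charFun_gammaMeasure_natCast {k : ℕ} (hk : 1 ≤ k) {r : ℝ} (hr : 0 < r) (t : ℝ) :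
    charFun (gammaMeasure k r) t = (r / (r - t * Complex.I)) ^ k := by
  obtain ⟨k, rfl⟩ : ∃ j, k = j + 1 := ⟨k - 1, by omega⟩
  have hb : 0 < ((r : ℂ) - t * Complex.I).re := by simpa using hr
  have hb0 : (r : ℂ) - t * Complex.I ≠ 0 := by intro h; rw [h] at hb; simp at hb
  rw [charFun_apply_real, integral_gammaMeasure (by positivity) hr]
  have h : ∀ x ∈ Set.Ioi (0 : ℝ),
      (r ^ ((k + 1 : ℕ) : ℝ) / Real.Gamma (k + 1 : ℕ) * x ^ (((k + 1 : ℕ) : ℝ) - 1) *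
        Real.exp (-(r * x))) • Complex.exp (t * x * Complex.I) =
      (r : ℂ) ^ (k + 1) / k.factorial *
        ((x : ℂ) ^ k * Complex.exp (-((r - t * Complex.I) * x))) := by
    intro x hx
    rw [show (((k + 1 : ℕ) : ℝ) - 1) = (k : ℕ) by push_cast; ring, Real.rpow_natCast,
      Real.rpow_natCast, Complex.real_smul,
      show (-((r - t * Complex.I) * x) : ℂ) = -(r * x) + t * x * Complex.I by ring,
      Complex.exp_add, Nat.cast_succ k, Real.Gamma_nat_eq_factorial]
    push_cast
    ring
  rw [setIntegral_congr_fun measurableSet_Ioi h, integral_const_mul,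
    integral_pow_mul_cexp_neg_mul_Ioi k hb, div_pow]
  have : (k.factorial : ℂ) ≠ 0 := by exact_mod_cast k.factorial_ne_zero
  field_simp

theorem integral_sub_one_sq_gammaMeasure {a : ℝ} (ha : 0 < a) :
    ∫ x, (x - 1) ^ 2 ∂(gammaMeasure a a) = a⁻¹ := by
  have := isProbabilityMeasure_gammaMeasure ha ha
  have h1 := integral_pow_gammaMeasure ha ha 1
  have h2 := integral_pow_gammaMeasure ha ha 2
  have i1 := integrable_pow_gammaMeasure ha ha 1
  have i2 := integrable_pow_gammaMeasure ha ha 2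
  have hG := (Real.Gamma_pos_of_pos ha).ne'
  have e : ∀ x : ℝ, (x - 1) ^ 2 = x ^ 2 - 2 * x ^ 1 + 1 := fun x => by ring
  simp_rw [e]
  have i3 : Integrable (fun x : ℝ => x ^ 2 - 2 * x ^ 1) (gammaMeasure a a) :=
    i2.sub (i1.const_mul 2)
  rw [integral_add i3 (integrable_const _),
    integral_sub i2 (i1.const_mul 2), integral_const_mul, h1, h2,
    show a + (2 : ℕ) = (a + 1) + 1 by push_cast; ring, Real.Gamma_add_one (by positivity),
    Nat.cast_one, Real.Gamma_add_one ha.ne']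
  simp
  field_simp
  ring

theorem integrable_sub_one_sq_gammaMeasure {a : ℝ} (ha : 0 < a) :
    Integrable (fun x => (x - 1) ^ 2) (gammaMeasure a a) := by
  have := isProbabilityMeasure_gammaMeasure ha ha
  have i1 := integrable_pow_gammaMeasure ha ha 1
  have i2 := integrable_pow_gammaMeasure ha ha 2
  have e : ∀ x : ℝ, (x - 1) ^ 2 = x ^ 2 - 2 * x ^ 1 + 1 := fun x => by ring
  simp_rw [e]
  exact (i2.sub (i1.const_mul 2)).add (integrable_const _)

/-! ### The standard complex normal law -/

instance isProbabilityMeasure_stdComplexNormal : IsProbabilityMeasure stdComplexNormal := by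
  unfold stdComplexNormal
  exact Measure.isProbabilityMeasure_map (by fun_prop)

instance isProbabilityMeasure_iidComplexNormal (ι κ : Type*) [Fintype ι] [Fintype κ] :
    IsProbabilityMeasure (iidComplexNormal ι κ) :=
  inferInstanceAs (IsProbabilityMeasure
    (Measure.pi fun _ : ι => Measure.pi fun _ : κ => stdComplexNormal))

theorem integral_stdComplexNormal {E : Type*} [NormedAddCommGroup E] [NormedSpace ℝ E]
    (f : ℂ → E) :
    ∫ z, f z ∂stdComplexNormal = ∫ p : ℝ × ℝ, f ((p.1 : ℂ) + p.2 * Complex.I)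
      ∂((gaussianReal 0 (1 / 2)).prod (gaussianReal 0 (1 / 2))) := by
  rw [stdComplexNormal, integral_map_equiv]
  congr 1 with p
  congr 1
  apply Complex.ext <;> simp [Complex.measurableEquivRealProd_symm_apply]

theorem charFunDual_stdComplexNormal (L : StrongDual ℝ ℂ) :
    charFunDual stdComplexNormal L =
      Complex.exp (-(((L 1) ^ 2 + (L Complex.I) ^ 2 : ℝ) : ℂ) / 4) := by
  have hL : ∀ p : ℝ × ℝ, Complex.exp (L ((p.1 : ℂ) + p.2 * Complex.I) * Complex.I) =
      Complex.exp ((L 1 : ℂ) * p.1 * Complex.I) *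
        Complex.exp ((L Complex.I : ℂ) * p.2 * Complex.I) := by
    intro p
    have : (p.1 : ℂ) + p.2 * Complex.I = p.1 • (1 : ℂ) + p.2 • Complex.I := by simp
    rw [this, map_add, map_smul, map_smul, ← Complex.exp_add]
    congr 1
    push_cast [smul_eq_mul]
    ring
  rw [charFunDual_apply, integral_stdComplexNormal]
  simp_rw [hL]
  rw [integral_prod_mul (fun x : ℝ => Complex.exp ((L 1 : ℂ) * x * Complex.I))
    (fun y : ℝ => Complex.exp ((L Complex.I : ℂ) * y * Complex.I)),
    ← charFun_apply_real, ← charFun_apply_real, charFun_gaussianReal, charFun_gaussianReal,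
    ← Complex.exp_add]
  congr 1
  push_cast
  ring

/-- Squaring removes the complex square root in the Gaussian integral. The square is also what is
wanted: `|z|²` is a sum of two independent such squares. -/
theorem integral_cexp_mul_sq_gaussianReal_half (s : ℝ) :
    (∫ x : ℝ, Complex.exp (s * x ^ 2 * Complex.I) ∂(gaussianReal 0 (1 / 2))) ^ 2 =
      1 / (1 - s * Complex.I) := by
  have hb : 0 < ((1 : ℂ) - s * Complex.I).re := by simp
  have hb0 : (1 : ℂ) - s * Complex.I ≠ 0 := by intro h; rw [h] at hb; simp at hb
  rw [integral_gaussianReal_eq_integral_smul (by norm_num)]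
  have h : ∀ x : ℝ, gaussianPDFReal 0 (1 / 2) x • Complex.exp (s * x ^ 2 * Complex.I) =
      ((Real.sqrt Real.pi)⁻¹ : ℝ) * Complex.exp (-(1 - s * Complex.I) * x ^ 2) := by
    intro x
    rw [gaussianPDFReal_def, Complex.real_smul,
      show (-(1 - s * Complex.I) * x ^ 2 : ℂ) = ((-x ^ 2 : ℝ) : ℂ) + s * x ^ 2 * Complex.I by
        push_cast; ring, Complex.exp_add, ← Complex.ofReal_exp, ← mul_assoc, ← Complex.ofReal_mul]
    have h2 : (Real.sqrt 2) ≠ 0 := by positivity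
    congr 3
    · norm_num
      field_simp
  simp_rw [h]
  rw [integral_const_mul, integral_gaussian_complex hb, mul_pow, ← Complex.ofReal_pow, inv_pow,
    Real.sq_sqrt Real.pi_pos.le, ← Complex.cpow_nat_mul]
  have : (Real.pi : ℂ) ≠ 0 := by exact_mod_cast Real.pi_ne_zero
  norm_num
  field_simp

theorem integral_cexp_mul_normSq_stdComplexNormal (s : ℝ) :
    ∫ z, Complex.exp (s * Complex.normSq z * Complex.I) ∂stdComplexNormal =
      1 / (1 - s * Complex.I) := by
  rw [integral_stdComplexNormal, ← integral_cexp_mul_sq_gaussianReal_half, pow_two,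
    ← integral_prod_mul]
  congr 1 with p
  rw [← Complex.exp_add, Complex.normSq_add_mul_I]
  congr 1
  push_cast
  ring

theorem map_normSq_stdComplexNormal :
    stdComplexNormal.map Complex.normSq = gammaMeasure (1 : ℕ) 1 := by
  have := isProbabilityMeasure_gammaMeasure (a := (1 : ℕ)) (r := 1) (by simp) one_pos
  have hm : Measurable Complex.normSq := Complex.continuous_normSq.measurable
  have : IsProbabilityMeasure (stdComplexNormal.map Complex.normSq) :=
    Measure.isProbabilityMeasure_map hm.aemeasurable
  apply Measure.ext_of_charFun
  ext t
  rw [charFun_gammaMeasure_natCast le_rfl one_pos, charFun_apply_real,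
    integral_map hm.aemeasurable (by fun_prop), integral_cexp_mul_normSq_stdComplexNormal]
  simp

theorem integrable_normSq_pow_stdComplexNormal (j : ℕ) :
    Integrable (fun z => Complex.normSq z ^ j) stdComplexNormal := by
  have hm : Measurable Complex.normSq := Complex.continuous_normSq.measurable
  have h := integrable_pow_gammaMeasure (a := (1 : ℕ)) (r := 1) (by simp) one_pos j
  rw [← map_normSq_stdComplexNormal, integrable_map_measure (by fun_prop) hm.aemeasurable] at h
  exact h

theorem integral_normSq_pow_stdComplexNormal (j : ℕ) :
    ∫ z, Complex.normSq z ^ j ∂stdComplexNormal = j.factorial := by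
  have hm : Measurable Complex.normSq := Complex.continuous_normSq.measurable
  have h := integral_pow_gammaMeasure (a := (1 : ℕ)) (r := 1) (by simp) one_pos j
  rw [← map_normSq_stdComplexNormal, integral_map hm.aemeasurable (by fun_prop)] at h
  rw [h, Nat.cast_one, add_comm, Real.Gamma_nat_eq_factorial]
  simp

/-- A quarter turn is all the rotation invariance needed to kill the unbalanced moments of low
order. -/
theorem map_I_mul_stdComplexNormal :
    stdComplexNormal.map (fun z => Complex.I * z) = stdComplexNormal := by
  let T : ℂ →L[ℝ] ℂ := ContinuousLinearMap.mul ℝ ℂ Complex.I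
  change stdComplexNormal.map T = stdComplexNormal
  have : IsProbabilityMeasure (stdComplexNormal.map T) :=
    Measure.isProbabilityMeasure_map (by fun_prop)
  apply Measure.ext_of_charFunDual
  ext L
  rw [charFunDual_map, charFunDual_stdComplexNormal, charFunDual_stdComplexNormal]
  simp [T, add_comm]

/-- The mixed moments of a standard complex normal variable, up to order `(2, 2)`. -/
theorem integral_pow_mul_conj_pow_stdComplexNormal {a b : ℕ} (ha : a ≤ 2) (hb : b ≤ 2) :
    ∫ z, z ^ a * (starRingEnd ℂ z) ^ b ∂stdComplexNormal = if a = b then (a.factorial : ℂ) else 0 := by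
  split_ifs with hab
  · subst hab
    simp_rw [← mul_pow, Complex.mul_conj, ← Complex.ofReal_pow]
    rw [integral_complex_ofReal, integral_normSq_pow_stdComplexNormal]
    simp
  · have h : ∫ z, z ^ a * (starRingEnd ℂ z) ^ b ∂stdComplexNormal =
        Complex.I ^ a * (-Complex.I) ^ b *
          ∫ z, z ^ a * (starRingEnd ℂ z) ^ b ∂stdComplexNormal := by
      conv_lhs => rw [← map_I_mul_stdComplexNormal]
      rw [integral_map (by fun_prop) (by fun_prop), ← integral_const_mul]
      congr 1 with z
      simp only [map_mul, Complex.conj_I, mul_pow]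
      ring
    -- The product is `I ^ (a - b)`, and `0 < |a - b| ≤ 2` rules out multiples of 4.
    have h1 : Complex.I ^ a * (-Complex.I) ^ b ≠ 1 := by
      interval_cases a <;> interval_cases b <;> simp [Complex.ext_iff] at hab ⊢ <;> norm_num
    have h2 : (1 - Complex.I ^ a * (-Complex.I) ^ b) *
        ∫ z, z ^ a * (starRingEnd ℂ z) ^ b ∂stdComplexNormal = 0 := by linear_combination h
    exact (mul_eq_zero.mp h2).resolve_left (sub_ne_zero.mpr h1.symm)

theorem integrable_pow_mul_conj_pow_stdComplexNormal (a b : ℕ) :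
    Integrable (fun z => z ^ a * (starRingEnd ℂ z) ^ b) stdComplexNormal := by
  refine Integrable.mono' ((integrable_const 1).add
    (integrable_normSq_pow_stdComplexNormal (a + b))) (by fun_prop) (ae_of_all _ fun z => ?_)
  simp only [norm_mul, norm_pow, RCLike.norm_conj, ← pow_add, Pi.add_apply, Complex.normSq_eq_norm_sq,
    ← pow_mul]
  rw [mul_comm 2, pow_mul]
  -- This is `t ≤ 1 + t²` at `t = ‖z‖ ^ (a + b)`.
  nlinarith [sq_nonneg (‖z‖ ^ (a + b) - 1), sq_nonneg (‖z‖ ^ (a + b))]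

/-! ### Contraction of a Gaussian matrix with a unit vector -/

/-- The vector `uᵀ X`, as a continuous real-linear function of the matrix `X`. -/
noncomputable def rowContraction {ι : Type*} (κ : Type*) [Fintype ι] (u : ι → ℝ) :
    (ι → κ → ℂ) →L[ℝ] (κ → ℂ) :=
  ∑ i, u i • ContinuousLinearMap.proj i

theorem rowContraction_apply {ι κ : Type*} [Fintype ι] (u : ι → ℝ) (X : ι → κ → ℂ) (j : κ) :
    rowContraction κ u X j = ∑ i, (u i : ℂ) * X i j := by
  simp [rowContraction, Finset.sum_apply]

/-- The logarithm of the characteristic functional is quadratic, so in each column contraction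
multiplies it by `∑ u i ^ 2 = 1`. -/
theorem map_rowContraction_iidComplexNormal {ι κ : Type*} [Fintype ι] [Fintype κ] (u : ι → ℝ)
    (hu : ∑ i, u i ^ 2 = 1) :
    (Measure.pi fun _ : ι => Measure.pi fun _ : κ => stdComplexNormal).map (rowContraction κ u) =
      Measure.pi fun _ : κ => stdComplexNormal := by
  classical
  have : IsProbabilityMeasure ((Measure.pi fun _ : ι => Measure.pi fun _ : κ =>
      stdComplexNormal).map (rowContraction κ u)) :=
    Measure.isProbabilityMeasure_map (by fun_prop)
  apply Measure.ext_of_charFunDual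
  ext L
  have hT : ∀ (i : ι) (j : κ) (z : ℂ),
      rowContraction κ u (Pi.single i (Pi.single j z)) = u i • Pi.single j z := by
    intro i j z
    ext l
    rw [rowContraction_apply, Finset.sum_eq_single i (fun b _ hb => by simp [hb]) (by simp)]
    simp
  rw [charFunDual_map, charFunDual_pi, charFunDual_pi]
  simp_rw [charFunDual_pi, charFunDual_stdComplexNormal]
  rw [Finset.prod_comm]
  refine Finset.prod_congr rfl fun j _ => ?_
  rw [← Complex.exp_sum]
  congr 1
  simp only [ContinuousLinearMap.comp_apply, ContinuousLinearMap.single_apply, hT, map_smul,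
    smul_eq_mul, mul_pow, ← mul_add]
  rw [← Finset.sum_div, Finset.sum_neg_distrib, ← Complex.ofReal_sum, ← Finset.sum_mul, hu, one_mul]

/-! ### The one-point law of the Wishart field -/

theorem measurable_matrix_apply {ι κ : Type*} (i : ι) (j : κ) :
    Measurable fun M : Matrix ι κ ℂ => M i j :=
  (measurable_pi_apply j).comp (measurable_pi_apply (X := fun _ : ι => κ → ℂ) i)

theorem measurable_matrix_of_apply {α ι κ : Type*} [MeasurableSpace α] {f : α → Matrix ι κ ℂ}
    (h : ∀ i j, Measurable fun a => f a i j) : Measurable f :=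
  measurable_pi_lambda _ fun i => measurable_pi_lambda _ (h i)

theorem measurable_mul_conjTranspose (ι κ : Type*) [Fintype κ] :
    Measurable fun G : Matrix ι κ ℂ => G * Gᴴ := by
  refine measurable_matrix_of_apply fun i j => ?_
  simp only [mul_apply, conjTranspose_apply]
  exact Finset.measurable_sum _ fun l _ =>
    (measurable_matrix_apply i l).mul (continuous_star.measurable.comp (measurable_matrix_apply j l))

theorem measurable_quadForm {ι : Type*} [Fintype ι] (u : ι → ℝ) :
    Measurable fun M : Matrix ι ι ℂ => quadForm M u := by
  unfold quadForm
  refine Complex.measurable_re.comp ?_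
  exact Finset.measurable_sum _ fun i _ => Finset.measurable_sum _ fun j _ =>
    ((measurable_matrix_apply i j).const_mul _).mul_const _

theorem measurable_whrfField {p : ℕ} (r : ℕ) (ν : ℝ) (θ : Fin p → ℝ) :
    Measurable (whrfField r ν θ) :=
  (measurable_quadForm _).const_mul _

theorem quadForm_mul_conjTranspose {ι κ : Type*} [Fintype ι] [Fintype κ] (u : ι → ℝ)
    (G : Matrix ι κ ℂ) :
    quadForm (G * Gᴴ) u = ∑ j, Complex.normSq (rowContraction κ u G j) := by
  have h : ∑ i, ∑ j, (u i : ℂ) * (G * Gᴴ) i j * (u j : ℂ) =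
      ((∑ j, Complex.normSq (rowContraction κ u G j) : ℝ) : ℂ) := by
    rw [Complex.ofReal_sum]
    have hr : ∀ l, ((Complex.normSq (rowContraction κ u G l) : ℝ) : ℂ) =
        ∑ i, ∑ j, (u i : ℂ) * G i l * star (G j l) * (u j : ℂ) := by
      intro l
      have e : rowContraction κ u G l = ∑ i, (u i : ℂ) * G i l := rowContraction_apply u G l
      rw [← Complex.mul_conj, e, map_sum, Finset.sum_mul_sum]
      refine Finset.sum_congr rfl fun i _ => Finset.sum_congr rfl fun j _ => ?_
      rw [map_mul, Complex.conj_ofReal, RCLike.star_def]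
      ring
    simp only [hr]
    refine Eq.trans (Finset.sum_congr rfl fun i _ => ?_) Finset.sum_comm
    refine Eq.trans ?_ Finset.sum_comm
    refine Finset.sum_congr rfl fun j _ => ?_
    rw [mul_apply, Finset.mul_sum, Finset.sum_mul]
    refine Finset.sum_congr rfl fun l _ => ?_
    rw [conjTranspose_apply]
    ring
  rw [quadForm, h, Complex.ofReal_re]

/-- Norms multiply under tensor products, and every factor satisfies `cos² + sin² = 1`. -/
theorem sum_torusTensor_sq {p : ℕ} (r : ℕ) (θ : Fin p → ℝ) : ∑ i, torusTensor r θ i ^ 2 = 1 := by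
  have h1 : ∑ i, torusPoint θ i ^ 2 = 1 := by
    simp_rw [torusPoint, ← Finset.prod_pow]
    rw [← Fintype.piFinset_univ, ← Finset.prod_univ_sum (fun _ => Finset.univ)
      (fun a i => circlePoint (θ a) i ^ 2)]
    simp [circlePoint]
  simp_rw [torusTensor, ← Finset.prod_pow]
  rw [← Fintype.piFinset_univ, ← Finset.prod_univ_sum (fun _ => Finset.univ)
    (fun _ i => torusPoint θ i ^ 2)]
  simp [h1]

theorem whrfLaw_eq_map_pi {p : ℕ} (r k : ℕ) (θ : Fin p → ℝ) :
    whrfLaw r k θ = (Measure.pi fun _ : Fin k => stdComplexNormal).map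
      fun z => (k : ℝ)⁻¹ * ∑ j, Complex.normSq (z j) := by
  have hm : Measurable Complex.normSq := Complex.continuous_normSq.measurable
  rw [whrfLaw, complexWishart, Measure.map_map (measurable_whrfField r k θ)
    (measurable_mul_conjTranspose _ _), ← map_rowContraction_iidComplexNormal _
    (sum_torusTensor_sq r θ), Measure.map_map (by fun_prop) (by fun_prop)]
  refine congrArg₂ Measure.map ?_ rfl
  ext G
  simp only [Function.comp_apply, whrfField, quadForm_mul_conjTranspose]
  rfl

theorem whrfLaw_eq_gammaMeasure {p : ℕ} (r : ℕ) {k : ℕ} (hk : 1 ≤ k) (θ : Fin p → ℝ) :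
    whrfLaw r k θ = gammaMeasure k k := by
  have hk0 : (0 : ℝ) < k := by exact_mod_cast hk
  have hm : Measurable Complex.normSq := Complex.continuous_normSq.measurable
  have hF : Measurable fun z : Fin k → ℂ => (k : ℝ)⁻¹ * ∑ j, Complex.normSq (z j) := by fun_prop
  have := isProbabilityMeasure_gammaMeasure hk0 hk0
  rw [whrfLaw_eq_map_pi]
  have : IsProbabilityMeasure ((Measure.pi fun _ : Fin k => stdComplexNormal).map
      fun z => (k : ℝ)⁻¹ * ∑ j, Complex.normSq (z j)) :=
    Measure.isProbabilityMeasure_map hF.aemeasurable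
  apply Measure.ext_of_charFun
  ext t
  have he : ∀ z : Fin k → ℂ,
      Complex.exp (t * (((k : ℝ)⁻¹ * ∑ j, Complex.normSq (z j) : ℝ) : ℂ) * Complex.I) =
        ∏ j, Complex.exp ((t / k : ℝ) * Complex.normSq (z j) * Complex.I) := by
    intro z
    rw [← Complex.exp_sum]
    congr 1
    push_cast
    rw [Finset.mul_sum, Finset.mul_sum, Finset.sum_mul]
    refine Finset.sum_congr rfl fun j _ => ?_
    ring
  rw [charFun_gammaMeasure_natCast hk hk0, charFun_apply_real,
    integral_map hF.aemeasurable (by fun_prop)]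
  simp_rw [he]
  rw [integral_fintype_prod_eq_pow
    (fun w : ℂ => Complex.exp ((t / k : ℝ) * Complex.normSq w * Complex.I)),
    integral_cexp_mul_normSq_stdComplexNormal, Fintype.card_fin]
  congr 1
  have : (k : ℂ) ≠ 0 := by exact_mod_cast hk0.ne'
  push_cast
  rw [show (1 - (t / k : ℂ) * Complex.I) = (k - t * Complex.I) / k by field_simp, one_div_div]

/-! ### Moments of quadratic forms in a Gaussian matrix -/

section Wick

variable {ι κ : Type*} [Fintype ι] [Fintype κ]

theorem integrable_monomial_iidComplexNormal (a b : ι × κ → ℕ) :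
    Integrable (fun X : Matrix ι κ ℂ => ∏ p, X p.1 p.2 ^ a p * starRingEnd ℂ (X p.1 p.2) ^ b p)
      (iidComplexNormal ι κ) := by
  simp_rw [Fintype.prod_prod_type]
  exact Integrable.fintype_prod (μ := fun _ : ι => Measure.pi fun _ : κ => stdComplexNormal)
    (f := fun i (x : κ → ℂ) => ∏ j, x j ^ a (i, j) * starRingEnd ℂ (x j) ^ b (i, j)) fun i =>
    Integrable.fintype_prod (f := fun j (z : ℂ) => z ^ a (i, j) * starRingEnd ℂ z ^ b (i, j))
      fun j => integrable_pow_mul_conj_pow_stdComplexNormal _ _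

theorem integral_monomial_iidComplexNormal {a b : ι × κ → ℕ} (ha : ∀ p, a p ≤ 2)
    (hb : ∀ p, b p ≤ 2) :
    ∫ X : Matrix ι κ ℂ, ∏ p, X p.1 p.2 ^ a p * starRingEnd ℂ (X p.1 p.2) ^ b p
      ∂(iidComplexNormal ι κ) = ∏ p, if a p = b p then ((a p).factorial : ℂ) else 0 := by
  simp_rw [Fintype.prod_prod_type]
  refine (integral_fintype_prod_eq_prod
    (μ := fun _ : ι => Measure.pi fun _ : κ => stdComplexNormal)
    (fun i (x : κ → ℂ) => ∏ j, x j ^ a (i, j) * starRingEnd ℂ (x j) ^ b (i, j))).trans ?_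
  refine Finset.prod_congr rfl fun i _ => ?_
  rw [integral_fintype_prod_eq_prod (μ := fun _ : κ => stdComplexNormal)
    (fun j (z : ℂ) => z ^ a (i, j) * starRingEnd ℂ z ^ b (i, j))]
  exact Finset.prod_congr rfl fun j _ => integral_pow_mul_conj_pow_stdComplexNormal (ha _) (hb _)

/-- The sesquilinear form with coefficients `W` in the entries of a matrix. -/
noncomputable def entryForm (W : Matrix (ι × κ) (ι × κ) ℂ) (X : Matrix ι κ ℂ) : ℂ :=
  ∑ α, ∑ β, W α β * (X α.1 α.2 * starRingEnd ℂ (X β.1 β.2))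

theorem entryForm_mul (W V : Matrix (ι × κ) (ι × κ) ℂ) (X : Matrix ι κ ℂ) :
    entryForm W X * entryForm V X = ∑ α, ∑ β, ∑ γ, ∑ δ, W α β * V γ δ *
      (X α.1 α.2 * starRingEnd ℂ (X β.1 β.2) * (X γ.1 γ.2 * starRingEnd ℂ (X δ.1 δ.2))) := by
  simp_rw [entryForm, Finset.sum_mul, Finset.mul_sum]
  refine Finset.sum_congr rfl fun α _ => Finset.sum_congr rfl fun β _ =>
    Finset.sum_congr rfl fun γ _ => Finset.sum_congr rfl fun δ _ => ?_
  ring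

/-- The coefficients in the entries of `X` of the quadratic form `uᵀ X B Xᴴ u`. -/
noncomputable def sandwichCoeff (u : ι → ℝ) (B : Matrix κ κ ℂ) : Matrix (ι × κ) (ι × κ) ℂ :=
  of fun α β => (u α.1 : ℂ) * u β.1 * B α.2 β.2

/-- `quadForm` takes a real part, which would obstruct Wick's formula; for Hermitian `B` the sum is
already real, so nothing is lost. -/
theorem quadForm_sandwich {B : Matrix κ κ ℂ} (hB : B.IsHermitian) (u : ι → ℝ)
    (X : Matrix ι κ ℂ) :
    (quadForm (X * B * Xᴴ) u : ℂ) = entryForm (sandwichCoeff u B) X := by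
  have h1 : ∑ i, ∑ j, (u i : ℂ) * (X * B * Xᴴ) i j * (u j : ℂ) =
      entryForm (sandwichCoeff u B) X := by
    simp only [entryForm, Fintype.sum_prod_type]
    refine Finset.sum_congr rfl fun i _ => ?_
    refine Eq.trans ?_ Finset.sum_comm
    refine Finset.sum_congr rfl fun j _ => ?_
    simp only [mul_apply, Finset.sum_mul, Finset.mul_sum, sandwichCoeff, of_apply,
      conjTranspose_apply, RCLike.star_def]
    refine Eq.trans Finset.sum_comm (Finset.sum_congr rfl fun a _ =>
      Finset.sum_congr rfl fun b _ => ?_)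
    ring
  have h2 : starRingEnd ℂ (entryForm (sandwichCoeff u B) X) = entryForm (sandwichCoeff u B) X := by
    simp only [entryForm, map_sum]
    refine Eq.trans Finset.sum_comm (Finset.sum_congr rfl fun α _ =>
      Finset.sum_congr rfl fun β _ => ?_)
    simp only [sandwichCoeff, of_apply, map_mul, Complex.conj_ofReal, Complex.conj_conj]
    rw [← hB.apply β.2 α.2, RCLike.star_def, Complex.conj_conj]
    ring
  rw [quadForm, h1]
  exact Complex.conj_eq_iff_re.mp h2

theorem trace_sandwichCoeff (u : ι → ℝ) (B : Matrix κ κ ℂ) :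
    (sandwichCoeff u B).trace = ((∑ i, u i ^ 2 : ℝ) : ℂ) * B.trace := by
  simp only [trace, diag_apply, sandwichCoeff, of_apply, Fintype.sum_prod_type]
  push_cast
  rw [Finset.sum_mul_sum]
  simp_rw [pow_two]

/-- The coefficient matrix is `u uᵀ ⊗ B`, so the trace factors as `tr (u uᵀ v vᵀ) · tr B²`. -/
theorem trace_sandwichCoeff_mul {B : Matrix κ κ ℂ} (hB : B.IsHermitian) (u v : ι → ℝ) :
    (sandwichCoeff u B * sandwichCoeff v B).trace =
      (((∑ i, u i * v i) ^ 2 * ∑ a, ∑ b, ‖B a b‖ ^ 2 : ℝ) : ℂ) := by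
  simp only [trace, diag_apply, mul_apply, sandwichCoeff, of_apply, Fintype.sum_prod_type]
  push_cast
  rw [pow_two, Finset.sum_mul_sum, Finset.sum_mul]
  refine Finset.sum_congr rfl fun i _ => ?_
  rw [Finset.sum_mul]
  refine Eq.trans Finset.sum_comm (Finset.sum_congr rfl fun j _ => ?_)
  rw [Finset.mul_sum]
  refine Finset.sum_congr rfl fun a _ => ?_
  rw [Finset.mul_sum]
  refine Finset.sum_congr rfl fun b _ => ?_
  have h : ((‖B a b‖ : ℝ) : ℂ) ^ 2 = B a b * B b a := by
    rw [← hB.apply b a, RCLike.star_def, Complex.mul_conj, Complex.normSq_eq_norm_sq]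
    push_cast
    rfl
  rw [h]
  ring

variable [DecidableEq ι] [DecidableEq κ]

theorem two_point_monomial_eq (X : Matrix ι κ ℂ) (α β : ι × κ) :
    X α.1 α.2 * starRingEnd ℂ (X β.1 β.2) =
      ∏ p, X p.1 p.2 ^ (if p = α then 1 else 0) *
        starRingEnd ℂ (X p.1 p.2) ^ (if p = β then 1 else 0) := by
  have h : ∀ (f : ι × κ → ℂ) (γ : ι × κ), ∏ p, f p ^ (if p = γ then 1 else 0) = f γ := by
    intro f γ
    rw [Finset.prod_eq_single γ (fun p _ hp => by simp [hp]) (by simp)]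
    simp
  rw [Finset.prod_mul_distrib, h (fun p => X p.1 p.2), h (fun p => starRingEnd ℂ (X p.1 p.2))]

theorem four_point_monomial_eq (X : Matrix ι κ ℂ) (α β γ δ : ι × κ) :
    X α.1 α.2 * starRingEnd ℂ (X β.1 β.2) * (X γ.1 γ.2 * starRingEnd ℂ (X δ.1 δ.2)) =
      ∏ p, X p.1 p.2 ^ ((if p = α then 1 else 0) + (if p = γ then 1 else 0)) *
        starRingEnd ℂ (X p.1 p.2) ^ ((if p = β then 1 else 0) + (if p = δ then 1 else 0)) := by
  rw [two_point_monomial_eq X α β, two_point_monomial_eq X γ δ, ← Finset.prod_mul_distrib]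
  refine Finset.prod_congr rfl fun p _ => ?_
  rw [pow_add, pow_add]
  ring

theorem integrable_two_point (α β : ι × κ) :
    Integrable (fun X : Matrix ι κ ℂ => X α.1 α.2 * starRingEnd ℂ (X β.1 β.2))
      (iidComplexNormal ι κ) := by
  simp_rw [two_point_monomial_eq]
  exact integrable_monomial_iidComplexNormal _ _

theorem integrable_four_point (α β γ δ : ι × κ) :
    Integrable (fun X : Matrix ι κ ℂ => X α.1 α.2 * starRingEnd ℂ (X β.1 β.2) *
      (X γ.1 γ.2 * starRingEnd ℂ (X δ.1 δ.2))) (iidComplexNormal ι κ) := by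
  simp_rw [four_point_monomial_eq]
  exact integrable_monomial_iidComplexNormal _ _

theorem integral_two_point (α β : ι × κ) :
    ∫ X : Matrix ι κ ℂ, X α.1 α.2 * starRingEnd ℂ (X β.1 β.2) ∂(iidComplexNormal ι κ) =
      if α = β then 1 else 0 := by
  simp_rw [two_point_monomial_eq]
  rw [integral_monomial_iidComplexNormal (fun p => by split_ifs <;> simp)
    (fun p => by split_ifs <;> simp)]
  split_ifs with h
  · subst h
    refine Finset.prod_eq_one fun p _ => ?_
    rw [if_pos rfl]
    split_ifs <;> simp
  · exact Finset.prod_eq_zero (Finset.mem_univ α) (by simp [h])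

/-- The product over a finite type of the moments of order `(a p, b p)`, where `a` and `b` count
the occurrences in `{α, γ}` and in `{β, δ}`. -/
theorem prod_pairing {τ : Type*} [Fintype τ] [DecidableEq τ] (α β γ δ : τ) :
    (∏ p : τ, if (if p = α then 1 else 0) + (if p = γ then 1 else 0) =
        (if p = β then 1 else 0) + (if p = δ then 1 else 0)
      then ((((if p = α then 1 else 0) + (if p = γ then 1 else 0) : ℕ).factorial : ℕ) : ℂ) else 0) =
      (if α = β then 1 else 0) * (if γ = δ then 1 else 0) +
        (if α = δ then 1 else 0) * (if γ = β then 1 else 0) := by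
  by_cases hαγ : α = γ
  · subst hαγ
    -- For `α = γ` the two pairings coincide, and their sum is the moment `2!` at that entry.
    by_cases h : α = β ∧ α = δ
    · obtain ⟨rfl, rfl⟩ := h
      rw [Finset.prod_eq_single α (fun p _ hp => by simp [hp]) (by simp)]
      simp
      norm_num
    · rw [Finset.prod_eq_zero (Finset.mem_univ α)]
      · grind
      · grind
  · by_cases h : (α = β ∧ γ = δ) ∨ (α = δ ∧ γ = β)
    · rw [Finset.prod_eq_one]
      · grind
      · intro p _
        have h1 : (if p = α then 1 else 0) + (if p = γ then 1 else 0) =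
            (if p = β then 1 else 0) + (if p = δ then 1 else 0) := by grind
        rw [if_pos h1]
        split_ifs with h2 h3
        · exact absurd (h2.symm.trans h3) hαγ
        all_goals simp
    -- A vanishing factor sits at an unmatched index: at `γ` if `α` is matched, and otherwise at
    -- `α`.
    · by_cases h1 : α = β ∨ α = δ
      · rw [Finset.prod_eq_zero (Finset.mem_univ γ)]
        · grind
        · grind
      · rw [Finset.prod_eq_zero (Finset.mem_univ α)]
        · grind
        · grind

theorem integral_four_point (α β γ δ : ι × κ) :
    ∫ X : Matrix ι κ ℂ, X α.1 α.2 * starRingEnd ℂ (X β.1 β.2) *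
      (X γ.1 γ.2 * starRingEnd ℂ (X δ.1 δ.2)) ∂(iidComplexNormal ι κ) =
      (if α = β then 1 else 0) * (if γ = δ then 1 else 0) +
        (if α = δ then 1 else 0) * (if γ = β then 1 else 0) := by
  simp_rw [four_point_monomial_eq]
  rw [integral_monomial_iidComplexNormal (fun p => by split_ifs <;> simp)
    (fun p => by split_ifs <;> simp), prod_pairing]

theorem integrable_entryForm (W : Matrix (ι × κ) (ι × κ) ℂ) :
    Integrable (entryForm W) (iidComplexNormal ι κ) :=
  integrable_finsetSum _ fun _ _ => integrable_finsetSum _ fun _ _ =>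
    (integrable_two_point _ _).const_mul _

theorem integral_entryForm (W : Matrix (ι × κ) (ι × κ) ℂ) :
    ∫ X, entryForm W X ∂(iidComplexNormal ι κ) = W.trace := by
  unfold entryForm
  refine (integral_finsetSum _ fun _ _ => integrable_finsetSum _ fun _ _ =>
    (integrable_two_point _ _).const_mul _).trans ?_
  refine Finset.sum_congr rfl fun α _ => ?_
  refine (integral_finsetSum _ fun _ _ => (integrable_two_point _ _).const_mul _).trans ?_
  simp_rw [integral_const_mul, integral_two_point]
  simp

theorem integrable_entryForm_mul (W V : Matrix (ι × κ) (ι × κ) ℂ) :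
    Integrable (fun X => entryForm W X * entryForm V X) (iidComplexNormal ι κ) := by
  simp_rw [entryForm_mul]
  exact integrable_finsetSum _ fun _ _ => integrable_finsetSum _ fun _ _ =>
    integrable_finsetSum _ fun _ _ => integrable_finsetSum _ fun _ _ =>
    (integrable_four_point _ _ _ _).const_mul _

/-- The pairing within each factor gives the product of traces; the pairing across the factors gives
the trace of the product. -/
theorem integral_entryForm_mul (W V : Matrix (ι × κ) (ι × κ) ℂ) :
    ∫ X, entryForm W X * entryForm V X ∂(iidComplexNormal ι κ) =
      W.trace * V.trace + (W * V).trace := by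
  have h : ∫ X, entryForm W X * entryForm V X ∂(iidComplexNormal ι κ) =
      ∑ α, ∑ β, ∑ γ, ∑ δ, W α β * V γ δ *
        ((if α = β then 1 else 0) * (if γ = δ then 1 else 0) +
        (if α = δ then 1 else 0) * (if γ = β then 1 else 0)) := by
    simp_rw [entryForm_mul]
    rw [integral_finsetSum _ fun _ _ => integrable_finsetSum _ fun _ _ =>
      integrable_finsetSum _ fun _ _ => integrable_finsetSum _ fun _ _ =>
      (integrable_four_point _ _ _ _).const_mul _]
    refine Finset.sum_congr rfl fun α _ => ?_
    rw [integral_finsetSum _ fun _ _ =>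
      integrable_finsetSum _ fun _ _ => integrable_finsetSum _ fun _ _ =>
      (integrable_four_point _ _ _ _).const_mul _]
    refine Finset.sum_congr rfl fun β _ => ?_
    rw [integral_finsetSum _ fun _ _ => integrable_finsetSum _ fun _ _ =>
      (integrable_four_point _ _ _ _).const_mul _]
    refine Finset.sum_congr rfl fun γ _ => ?_
    rw [integral_finsetSum _ fun _ _ => (integrable_four_point _ _ _ _).const_mul _]
    simp_rw [integral_const_mul, integral_four_point]
  rw [h]
  simp_rw [mul_add, Finset.sum_add_distrib]
  congr 1
  · rw [trace, trace, Finset.sum_mul_sum]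
    refine Finset.sum_congr rfl fun α _ => ?_
    simp
  · rw [trace]
    refine Finset.sum_congr rfl fun α _ => ?_
    rw [diag_apply, mul_apply]
    refine Finset.sum_congr rfl fun β _ => ?_
    simp

theorem integrable_quadForm_sandwich {B : Matrix κ κ ℂ} (hB : B.IsHermitian) (u : ι → ℝ) :
    Integrable (fun X : Matrix ι κ ℂ => quadForm (X * B * Xᴴ) u) (iidComplexNormal ι κ) := by
  have h := (integrable_entryForm (sandwichCoeff u B)).re
  simp_rw [← quadForm_sandwich hB] at h
  simpa using h

theorem integral_quadForm_sandwich {B : Matrix κ κ ℂ} (hB : B.IsHermitian) (u : ι → ℝ) :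
    ∫ X : Matrix ι κ ℂ, quadForm (X * B * Xᴴ) u ∂(iidComplexNormal ι κ) =
      (∑ i, u i ^ 2) * B.trace.re := by
  have h := integral_entryForm (sandwichCoeff u B)
  simp_rw [← quadForm_sandwich hB] at h
  rw [integral_complex_ofReal, trace_sandwichCoeff] at h
  rw [← Complex.re_ofReal_mul, ← h, Complex.ofReal_re]

theorem integrable_quadForm_sandwich_mul {B : Matrix κ κ ℂ} (hB : B.IsHermitian) (u v : ι → ℝ) :
    Integrable (fun X : Matrix ι κ ℂ => quadForm (X * B * Xᴴ) u * quadForm (X * B * Xᴴ) v)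
      (iidComplexNormal ι κ) := by
  have h := (integrable_entryForm_mul (sandwichCoeff u B) (sandwichCoeff v B)).re
  simp_rw [← quadForm_sandwich hB, ← Complex.ofReal_mul] at h
  simpa using h

theorem integral_quadForm_sandwich_mul {B : Matrix κ κ ℂ} (hB : B.IsHermitian) {t : ℝ}
    (ht : B.trace = t) (u v : ι → ℝ) :
    ∫ X : Matrix ι κ ℂ, quadForm (X * B * Xᴴ) u * quadForm (X * B * Xᴴ) v
        ∂(iidComplexNormal ι κ) =
      (∑ i, u i ^ 2) * (∑ i, v i ^ 2) * t ^ 2 + (∑ i, u i * v i) ^ 2 * ∑ a, ∑ b, ‖B a b‖ ^ 2 := by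
  have h := integral_entryForm_mul (sandwichCoeff u B) (sandwichCoeff v B)
  simp_rw [← quadForm_sandwich hB, ← Complex.ofReal_mul] at h
  rw [integral_complex_ofReal, trace_sandwichCoeff, trace_sandwichCoeff,
    trace_sandwichCoeff_mul hB, ht] at h
  rw [← Complex.ofReal_inj, h]
  push_cast
  ring

end Wick

/-! ### Spectral data -/

/-- The eigenvalues of `Aᴴ A` are the squares of those of `A`. The two enumerations need not agree,
so they are compared as multisets of roots of the characteristic polynomial. -/
theorem nuclearNorm_eq_re_trace {κ : Type*} [Fintype κ] [DecidableEq κ] {A : Matrix κ κ ℂ}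
    (hA : A.IsHermitian) (h0 : ∀ i, 0 ≤ hA.eigenvalues i) : nuclearNorm A = A.trace.re := by
  have hpoly : (Aᴴ * A).charpoly =
      ∏ i, (Polynomial.X - Polynomial.C ((hA.eigenvalues i ^ 2 : ℝ) : ℂ)) := by
    rw [hA.eq]
    conv_lhs => rw [hA.spectral_theorem, ← map_mul, Unitary.conjStarAlgAut_apply,
      charpoly_mul_comm, ← mul_assoc]
    simp [charpoly_diagonal, pow_two]
  have hroots := (isHermitian_conjTranspose_mul_self A).roots_charpoly_eq_eigenvalues
  rw [hpoly, Polynomial.roots_prod _ _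
    (Finset.prod_ne_zero_iff.mpr fun _ _ => Polynomial.X_sub_C_ne_zero _)] at hroots
  have hsum := congrArg (fun s => (s.map fun z : ℂ => Real.sqrt z.re).sum) hroots
  simp only [Polynomial.roots_X_sub_C, Multiset.bind_singleton, Multiset.map_map,
    Function.comp_apply, Complex.ofReal_re] at hsum
  rw [nuclearNorm, hA.trace_eq_sum_eigenvalues]
  simp only [Complex.re_sum]
  refine Eq.trans hsum.symm (Finset.sum_congr rfl fun i _ => ?_)
  rw [Real.sqrt_sq (h0 i)]
  rfl

theorem sum_norm_sq_eq_sum_eigenvalues_sq {κ : Type*} [Fintype κ] [DecidableEq κ]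
    {A : Matrix κ κ ℂ} (hA : A.IsHermitian) :
    ∑ i, ∑ j, ‖A i j‖ ^ 2 = ∑ i, hA.eigenvalues i ^ 2 := by
  have h1 : (A * A).trace = ((∑ i, ∑ j, ‖A i j‖ ^ 2 : ℝ) : ℂ) := by
    rw [trace]
    push_cast
    refine Finset.sum_congr rfl fun i _ => ?_
    rw [diag_apply, mul_apply]
    refine Finset.sum_congr rfl fun j _ => ?_
    rw [← hA.apply j i, RCLike.star_def, Complex.mul_conj, Complex.normSq_eq_norm_sq]
    push_cast
    rfl
  have h2 : (A * A).trace = ((∑ i, hA.eigenvalues i ^ 2 : ℝ) : ℂ) := by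
    conv_lhs => rw [hA.spectral_theorem, ← map_mul, Unitary.conjStarAlgAut_apply, trace_mul_cycle]
    simp [trace_diagonal, pow_two]
  exact_mod_cast h1.symm.trans h2

section Hamiltonian

variable {n : ℕ} {H : Matrix (Fin (2 ^ n)) (Fin (2 ^ n)) ℂ}

theorem isHermitian_shiftBy (hH : H.IsHermitian) (a : ℝ) : (shiftBy H a).IsHermitian := by
  unfold shiftBy
  refine hH.sub ?_
  rw [IsHermitian, conjTranspose_smul, conjTranspose_one]
  simp

theorem isHermitian_scaledHam (hH : H.IsHermitian) : (scaledHam H).IsHermitian := by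
  unfold scaledHam
  rw [IsHermitian, conjTranspose_smul, (isHermitian_shiftBy hH _).eq]
  simp

theorem trace_shiftBy (H : Matrix (Fin (2 ^ n)) (Fin (2 ^ n)) ℂ) (a : ℝ) :
    (shiftBy H a).trace = H.trace - a * 2 ^ n := by
  simp [shiftBy, trace_sub, trace_smul]

theorem re_trace_shiftBy (H : Matrix (Fin (2 ^ n)) (Fin (2 ^ n)) ℂ) (a : ℝ) :
    (shiftBy H a).trace.re = 2 ^ n * (meanEigenvalue H - a) := by
  rw [trace_shiftBy, meanEigenvalue, Complex.sub_re,
    show (a : ℂ) * 2 ^ n = ((a * 2 ^ n : ℝ) : ℂ) by push_cast; rfl, Complex.ofReal_re]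
  field_simp

theorem trace_eq_ofReal_re {κ : Type*} [Fintype κ] {A : Matrix κ κ ℂ} (hA : A.IsHermitian) :
    A.trace = (A.trace.re : ℂ) := by
  rw [eq_comm, ← Complex.conj_eq_iff_re, ← RCLike.star_def, ← trace_conjTranspose, hA.eq]

theorem trace_scaledHam (hH : H.IsHermitian) : (scaledHam H).trace = 0 := by
  rw [trace_eq_ofReal_re (isHermitian_scaledHam hH), scaledHam, trace_smul, smul_eq_mul,
    Complex.re_ofReal_mul, re_trace_shiftBy]
  simp

theorem mem_spectrum_of_mem_spectrum_smul_shiftBy {c : ℝ} (hc : c ≠ 0) {a x : ℝ}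
    (hx : x ∈ spectrum ℝ ((c : ℂ) • shiftBy H a)) : c⁻¹ * x + a ∈ spectrum ℝ H := by
  rw [spectrum.mem_iff] at hx ⊢
  intro h
  apply hx
  have hcu : IsUnit (algebraMap ℝ (Matrix (Fin (2 ^ n)) (Fin (2 ^ n)) ℂ) c) :=
    (IsUnit.mk0 c hc).map _
  convert hcu.mul h using 1
  have hx' : c * (c⁻¹ * x + a) = x + c * a := by field_simp
  rw [mul_sub, ← map_mul, hx', map_add, map_mul]
  simp only [shiftBy, Algebra.algebraMap_eq_smul_one, smul_sub, smul_mul_assoc, one_mul,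
    Complex.coe_smul]
  abel

theorem groundEnergy_le {x : ℝ} (hx : x ∈ spectrum ℝ H) :
    groundEnergy H ≤ x :=
  csInf_le (finite_real_spectrum (A := H)).bddBelow hx

theorem eigenvalues_shiftBy_groundEnergy_nonneg (hH : H.IsHermitian) (i : Fin (2 ^ n)) :
    0 ≤ (isHermitian_shiftBy hH (groundEnergy H)).eigenvalues i := by
  have h := (isHermitian_shiftBy hH (groundEnergy H)).eigenvalues_mem_spectrum_real i
  have := groundEnergy_le (mem_spectrum_of_mem_spectrum_smul_shiftBy (c := 1) one_ne_zero
    (by simpa using h))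
  simp only [inv_one, one_mul] at this
  linarith

/-- Otherwise the positive semidefinite matrix `H - λ₁` would have trace 0 and so vanish, making `H`
a multiple of the identity. -/
theorem groundEnergy_lt_meanEigenvalue (hH : H.IsHermitian)
    (hs : ∀ a : ℝ, H ≠ (a : ℂ) • (1 : Matrix (Fin (2 ^ n)) (Fin (2 ^ n)) ℂ)) :
    groundEnergy H < meanEigenvalue H := by
  have hA := isHermitian_shiftBy hH (groundEnergy H)
  have h0 := eigenvalues_shiftBy_groundEnergy_nonneg hH
  have ht := re_trace_shiftBy H (groundEnergy H)
  rw [hA.trace_eq_sum_eigenvalues] at ht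
  simp only [Complex.re_sum] at ht
  have hpos : (0 : ℝ) < 2 ^ n := by positivity
  have hsum : 0 ≤ ∑ i, hA.eigenvalues i := Finset.sum_nonneg fun i _ => h0 i
  rw [← sub_pos]
  by_contra hcon
  have hz : ∑ i, hA.eigenvalues i = 0 := by
    refine le_antisymm ?_ hsum
    have ht' : ∑ i, hA.eigenvalues i = 2 ^ n * (meanEigenvalue H - groundEnergy H) := ht
    rw [ht']
    exact mul_nonpos_of_nonneg_of_nonpos hpos.le (not_lt.mp hcon)
  rw [Finset.sum_eq_zero_iff_of_nonneg fun i _ => h0 i] at hz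
  have hA0 : shiftBy H (groundEnergy H) = 0 :=
    hA.eigenvalues_eq_zero_iff.mp (funext fun i => hz i (Finset.mem_univ i))
  exact hs _ (sub_eq_zero.mp hA0)

theorem neg_one_le_eigenvalues_scaledHam (hH : H.IsHermitian)
    (hs : ∀ a : ℝ, H ≠ (a : ℂ) • (1 : Matrix (Fin (2 ^ n)) (Fin (2 ^ n)) ℂ))
    (i : Fin (2 ^ n)) :
    -1 ≤ (isHermitian_scaledHam hH).eigenvalues i := by
  have hg := sub_pos.mpr (groundEnergy_lt_meanEigenvalue hH hs)
  have h := (isHermitian_scaledHam hH).eigenvalues_mem_spectrum_real i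
  have := groundEnergy_le
    (mem_spectrum_of_mem_spectrum_smul_shiftBy (inv_ne_zero hg.ne') h)
  rw [inv_inv] at this
  nlinarith

theorem effDOF_eq (hH : H.IsHermitian)
    (hs : ∀ a : ℝ, H ≠ (a : ℂ) • (1 : Matrix (Fin (2 ^ n)) (Fin (2 ^ n)) ℂ)) :
    effDOF H = (2 ^ n) ^ 2 / ∑ i, ∑ j, ‖scaledHam H i j‖ ^ 2 := by
  have hg := sub_pos.mpr (groundEnergy_lt_meanEigenvalue hH hs)
  rw [effDOF, nuclearNorm_eq_re_trace _ (eigenvalues_shiftBy_groundEnergy_nonneg hH),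
    re_trace_shiftBy, frobNorm, Real.sq_sqrt (by positivity)]
  have h : ∀ i j, ‖scaledHam H i j‖ ^ 2 = ((meanEigenvalue H - groundEnergy H)⁻¹) ^ 2 *
      ‖shiftBy H (meanEigenvalue H) i j‖ ^ 2 := by
    intro i j
    rw [scaledHam, Matrix.smul_apply, norm_smul, mul_pow, Complex.norm_real, Real.norm_eq_abs,
      sq_abs]
  simp_rw [h, ← Finset.mul_sum]
  rw [inv_pow, mul_pow, ← div_div, div_inv_eq_mul]

theorem sum_norm_scaledHam_sq_pos (hH : H.IsHermitian)
    (hs : ∀ a : ℝ, H ≠ (a : ℂ) • (1 : Matrix (Fin (2 ^ n)) (Fin (2 ^ n)) ℂ)) :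
    0 < ∑ i, ∑ j, ‖scaledHam H i j‖ ^ 2 := by
  have hg := sub_pos.mpr (groundEnergy_lt_meanEigenvalue hH hs)
  refine lt_of_le_of_ne (by positivity) fun h0 => hs (meanEigenvalue H) ?_
  have h : scaledHam H = 0 := by
    ext i j
    have h1 := (Finset.sum_eq_zero_iff_of_nonneg (fun i _ => by positivity)).mp h0.symm i
      (Finset.mem_univ i)
    have h2 := (Finset.sum_eq_zero_iff_of_nonneg (fun j _ => by positivity)).mp h1 j
      (Finset.mem_univ j)
    simpa using h2
  rw [scaledHam, smul_eq_zero] at h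
  have h' := h.resolve_left (by exact_mod_cast inv_ne_zero hg.ne')
  exact sub_eq_zero.mp h'

theorem sum_eigenvalues_scaledHam (hH : H.IsHermitian) :
    ∑ i, (isHermitian_scaledHam hH).eigenvalues i = 0 := by
  have h := (isHermitian_scaledHam hH).trace_eq_sum_eigenvalues
  rw [trace_scaledHam hH] at h
  rw [← Complex.ofReal_inj, Complex.ofReal_sum]
  exact h.symm

/-- The eigenvalues of `1 + H̃` are nonnegative with sum `2ⁿ`, so the sum of their squares, `2ⁿ +
‖H̃‖_F²`, is at most `4ⁿ`. This keeps the rounded `k` positive. -/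
theorem one_lt_effDOF (hH : H.IsHermitian)
    (hs : ∀ a : ℝ, H ≠ (a : ℂ) • (1 : Matrix (Fin (2 ^ n)) (Fin (2 ^ n)) ℂ)) :
    1 < effDOF H := by
  have hpos := sum_norm_scaledHam_sq_pos hH hs
  rw [effDOF_eq hH hs, one_lt_div hpos, sum_norm_sq_eq_sum_eigenvalues_sq
    (isHermitian_scaledHam hH)]
  have h1 := Finset.sum_sq_le_sq_sum_of_nonneg (s := Finset.univ)
    (f := fun i => 1 + (isHermitian_scaledHam hH).eigenvalues i)
    fun i _ => by linarith [neg_one_le_eigenvalues_scaledHam hH hs i]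
  have h2 : ∑ i, (1 + (isHermitian_scaledHam hH).eigenvalues i) = 2 ^ n := by
    rw [Finset.sum_add_distrib, sum_eigenvalues_scaledHam hH]
    simp
  have h3 : ∑ i, (1 + (isHermitian_scaledHam hH).eigenvalues i) ^ 2 =
      2 ^ n + ∑ i, (isHermitian_scaledHam hH).eigenvalues i ^ 2 := by
    simp_rw [add_sq, Finset.sum_add_distrib, mul_one, ← Finset.mul_sum,
      sum_eigenvalues_scaledHam hH]
    simp
  have : (0 : ℝ) < 2 ^ n := by positivity
  rw [h2, h3] at h1
  linarith

theorem rpow_le_two_mul_effDOF (hH : H.IsHermitian)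
    (hs : ∀ a : ℝ, H ≠ (a : ℂ) • (1 : Matrix (Fin (2 ^ n)) (Fin (2 ^ n)) ℂ))
    {c : ℝ} (hc : 0 ≤ c)
    (hmax : ∀ x ∈ spectrum ℝ (scaledHam H), x ≤ (2 : ℝ) ^ (c * (n : ℝ))) :
    (2 : ℝ) ^ ((1 - c) * (n : ℝ)) ≤ 2 * effDOF H := by
  have hpos := sum_norm_scaledHam_sq_pos hH hs
  have hB : (1 : ℝ) ≤ (2 : ℝ) ^ (c * (n : ℝ)) := Real.one_le_rpow one_le_two (by positivity)
  have hle : ∑ i, (isHermitian_scaledHam hH).eigenvalues i ^ 2 ≤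
      2 * (2 : ℝ) ^ (c * (n : ℝ)) * 2 ^ n := by
    calc ∑ i, (isHermitian_scaledHam hH).eigenvalues i ^ 2
        -- On `[-1, B]` with `B ≥ 1` one has `x² ≤ B (x + 2)`; the bound is affine in `x`, so it
        -- sums using only that `H̃` is traceless.
        ≤ ∑ i, (2 : ℝ) ^ (c * (n : ℝ)) * ((isHermitian_scaledHam hH).eigenvalues i + 2) := by
          refine Finset.sum_le_sum fun i _ => ?_
          have h1 := neg_one_le_eigenvalues_scaledHam hH hs i
          have h2 := hmax _ ((isHermitian_scaledHam hH).eigenvalues_mem_spectrum_real i)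
          by_cases h : 0 ≤ (isHermitian_scaledHam hH).eigenvalues i <;> nlinarith
      _ = _ := by
          rw [← Finset.mul_sum, Finset.sum_add_distrib, sum_eigenvalues_scaledHam hH]
          simp
          ring
  rw [sum_norm_sq_eq_sum_eigenvalues_sq (isHermitian_scaledHam hH)] at hpos
  rw [effDOF_eq hH hs, sum_norm_sq_eq_sum_eigenvalues_sq (isHermitian_scaledHam hH),
    mul_div_assoc', le_div_iff₀ hpos]
  refine (mul_le_mul_of_nonneg_left hle (by positivity)).trans (le_of_eq ?_)
  have he : (2 : ℝ) ^ ((1 - c) * (n : ℝ)) * (2 : ℝ) ^ (c * (n : ℝ)) = 2 ^ n := by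
    rw [← Real.rpow_add two_pos, ← Real.rpow_natCast]
    congr 1
    ring
  linear_combination (2 * 2 ^ n) * he

end Hamiltonian

/-! ### The Lévy distance of laws concentrated near `1` -/

/-- Each distribution function is at most `ε` up to `1 - ε/2` and at least `1 - ε` from `1 + ε/2`
on. This gap has width `ε`, so of the two arguments compared, differing by `ε`, one always lies
outside it on the useful side. -/
theorem levyDist_le_of_concentrated {μ ν : Measure ℝ} [IsProbabilityMeasure μ]
    [IsProbabilityMeasure ν] {ε : ℝ} (hε : 0 < ε)
    (hμ : μ.real {x | ε / 2 ≤ |x - 1|} ≤ ε) (hν : ν.real {x | ε / 2 ≤ |x - 1|} ≤ ε) :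
    levyDist μ ν ≤ ε := by
  have low : ∀ (ρ : Measure ℝ) [IsProbabilityMeasure ρ], ρ.real {x | ε / 2 ≤ |x - 1|} ≤ ε →
      ∀ x, x ≤ 1 - ε / 2 → cdf ρ x ≤ ε := by
    intro ρ _ h x hx
    rw [cdf_eq_real]
    refine (measureReal_mono ?_).trans h
    intro y hy
    have hy : y ≤ x := hy
    have := neg_le_abs (y - 1)
    show ε / 2 ≤ |y - 1|
    linarith
  have high : ∀ (ρ : Measure ℝ) [IsProbabilityMeasure ρ], ρ.real {x | ε / 2 ≤ |x - 1|} ≤ ε →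
      ∀ x, 1 + ε / 2 ≤ x → 1 ≤ cdf ρ x + ε := by
    intro ρ _ h x hx
    have h1 : ρ.real (Set.Iic x)ᶜ ≤ ε := by
      refine (measureReal_mono ?_).trans h
      intro y hy
      have hy : x < y := by simpa using hy
      have := le_abs_self (y - 1)
      show ε / 2 ≤ |y - 1|
      linarith
    rw [probReal_compl_eq_one_sub measurableSet_Iic] at h1
    rw [cdf_eq_real]
    linarith
  refine csInf_le ⟨0, fun e he => he.1.le⟩ ⟨hε, fun x => ⟨?_, ?_⟩⟩
  · have h0 := cdf_nonneg ν x
    have h1 := cdf_le_one μ (x - ε)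
    by_cases hx : 1 + ε / 2 ≤ x
    · linarith [high ν hν x hx]
    · linarith [low μ hμ (x - ε) (by linarith)]
  · have h0 := cdf_nonneg μ (x + ε)
    have h1 := cdf_le_one ν x
    by_cases hx : x ≤ 1 - ε / 2
    · linarith [low ν hν x hx]
    · linarith [high μ hμ (x + ε) (by linarith)]

/-- Chebyshev's inequality at threshold `ε/2`: the probability is at most `4 s / ε²`. -/
theorem measureReal_abs_sub_one_ge_le {μ : Measure ℝ} [IsProbabilityMeasure μ] {ε s : ℝ}
    (hε : 0 < ε) (hi : Integrable (fun x => (x - 1) ^ 2) μ) (hs : ∫ x, (x - 1) ^ 2 ∂μ ≤ s)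
    (hsε : 4 * s ≤ ε ^ 3) : μ.real {x | ε / 2 ≤ |x - 1|} ≤ ε := by
  have h := mul_meas_ge_le_integral_of_nonneg (ae_of_all μ fun x => sq_nonneg (x - 1)) hi
    ((ε / 2) ^ 2)
  have he : {x : ℝ | (ε / 2) ^ 2 ≤ (x - 1) ^ 2} = {x | ε / 2 ≤ |x - 1|} := by
    ext x
    simp only [Set.mem_ofPred_eq]
    rw [sq_le_sq, abs_of_pos (half_pos hε)]
  rw [he] at h
  have hp : (0 : ℝ) < ε ^ 2 := by positivity
  have : ε ^ 2 * μ.real {x | ε / 2 ≤ |x - 1|} ≤ ε ^ 2 * ε := by nlinarith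
  exact le_of_mul_le_mul_left this hp

/-- Two laws on the line with mean-square deviation from `1` at most `2 / m` have Lévy distance at
most `2 m^(-1/3)`. -/
theorem levyDist_le_of_integral_sub_one_sq_le {μ ν : Measure ℝ} [IsProbabilityMeasure μ]
    [IsProbabilityMeasure ν] {m : ℝ} (hm : 0 < m)
    (hiμ : Integrable (fun x => (x - 1) ^ 2) μ) (hμ : ∫ x, (x - 1) ^ 2 ∂μ ≤ 2 / m)
    (hiν : Integrable (fun x => (x - 1) ^ 2) ν) (hν : ∫ x, (x - 1) ^ 2 ∂ν ≤ 2 / m) :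
    levyDist μ ν ≤ 2 * m ^ (-(1 / 3) : ℝ) := by
  have hε : 0 < 2 * m ^ (-(1 / 3) : ℝ) := by positivity
  -- Both sides equal `8 / m`, which dictates the choice of `ε`.
  have hc : 4 * (2 / m) ≤ (2 * m ^ (-(1 / 3) : ℝ)) ^ 3 := by
    rw [mul_pow, ← Real.rpow_natCast (m ^ _), ← Real.rpow_mul hm.le]
    norm_num [Real.rpow_neg_one]
    apply le_of_eq
    ring
  exact levyDist_le_of_concentrated hε (measureReal_abs_sub_one_ge_le hε hiμ hμ hc)
    (measureReal_abs_sub_one_ge_le hε hiν hν hc)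

/-- With `L = lg m`, the exponents satisfy `1 - L/3 ≤ -L/6` exactly when `L ≥ 6`, that is, `m ≥ 64`.
-/
theorem two_mul_rpow_le_two_rpow_min {m : ℝ} (hm : 64 ≤ m) (x : ℝ) :
    2 * m ^ (-(1 / 3) : ℝ) ≤ (2 : ℝ) ^ (-(1 / 6 * min x (Real.logb 2 m))) := by
  have hm0 : 0 < m := by linarith
  have hl : (6 : ℝ) ≤ Real.logb 2 m := by
    rw [Real.le_logb_iff_rpow_le (by norm_num) hm0]
    norm_num
    exact hm
  calc 2 * m ^ (-(1 / 3) : ℝ) = (2 : ℝ) ^ (1 + Real.logb 2 m * (-(1 / 3))) := by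
        rw [Real.rpow_add two_pos, Real.rpow_one, Real.rpow_mul two_pos.le,
          Real.rpow_logb two_pos (by norm_num) hm0]
    _ ≤ _ := by
        apply Real.rpow_le_rpow_of_exponent_le one_le_two
        have := min_le_right x (Real.logb 2 m)
        linarith

/-! ### The first two moments of the two random fields -/

section Fields

variable {n p : ℕ} {H : Matrix (Fin (2 ^ n)) (Fin (2 ^ n)) ℂ}

theorem effDOF_pos (hH : H.IsHermitian)
    (hs : ∀ a : ℝ, H ≠ (a : ℂ) • (1 : Matrix (Fin (2 ^ n)) (Fin (2 ^ n)) ℂ)) : 0 < effDOF H :=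
  zero_lt_one.trans (one_lt_effDOF hH hs)

theorem integrable_xhxField (hH : H.IsHermitian) (r : ℕ) (θ : Fin p → ℝ) :
    Integrable (xhxField r H θ) (iidComplexNormal _ _) :=
  ((integrable_quadForm_sandwich (isHermitian_scaledHam hH) _).const_mul _).add
    (integrable_const _)

theorem integral_xhxField (hH : H.IsHermitian) (r : ℕ) (θ : Fin p → ℝ) :
    ∫ X, xhxField r H θ X ∂(iidComplexNormal _ _) = 1 := by
  have hB := isHermitian_scaledHam hH
  unfold xhxField
  rw [integral_add ((integrable_quadForm_sandwich hB _).const_mul _) (integrable_const _),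
    integral_const_mul, integral_quadForm_sandwich hB, trace_scaledHam hH]
  simp

theorem xhxField_mul (r : ℕ) (θ θ' : Fin p → ℝ)
    (X : Matrix (Fin r → Fin p → Fin 2) (Fin (2 ^ n)) ℂ) :
    xhxField r H θ X * xhxField r H θ' X =
      (((2 : ℝ) ^ n)⁻¹ ^ 2 * (quadForm (X * scaledHam H * Xᴴ) (torusTensor r θ) *
        quadForm (X * scaledHam H * Xᴴ) (torusTensor r θ')) + xhxField r H θ X) +
      (xhxField r H θ' X - 1) := by
  unfold xhxField
  ring

theorem integrable_xhxField_mul (hH : H.IsHermitian) (r : ℕ) (θ θ' : Fin p → ℝ) :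
    Integrable (fun X => xhxField r H θ X * xhxField r H θ' X) (iidComplexNormal _ _) := by
  simp_rw [xhxField_mul]
  exact (((integrable_quadForm_sandwich_mul (isHermitian_scaledHam hH) _ _).const_mul _).add
    (integrable_xhxField hH r θ)).add ((integrable_xhxField hH r θ').sub (integrable_const _))

theorem integral_xhxField_mul (hH : H.IsHermitian)
    (hs : ∀ a : ℝ, H ≠ (a : ℂ) • (1 : Matrix (Fin (2 ^ n)) (Fin (2 ^ n)) ℂ))
    (r : ℕ) (θ θ' : Fin p → ℝ) :
    ∫ X, xhxField r H θ X * xhxField r H θ' X ∂(iidComplexNormal _ _) =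
      1 + (∑ i, torusTensor r θ i * torusTensor r θ' i) ^ 2 / effDOF H := by
  have hB := isHermitian_scaledHam hH
  have hi := (integrable_quadForm_sandwich_mul hB (torusTensor r θ) (torusTensor r θ')).const_mul
    (((2 : ℝ) ^ n)⁻¹ ^ 2)
  have hpos := sum_norm_scaledHam_sq_pos hH hs
  have h1 := integrable_xhxField hH r θ
  have h2 := integrable_xhxField hH r θ'
  have h3 : Integrable (fun X => xhxField r H θ' X - 1) (iidComplexNormal _ _) :=
    h2.sub (integrable_const _)
  simp_rw [xhxField_mul]
  refine (integral_add (hi.add h1) h3).trans ?_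
  simp only [Pi.add_apply]
  rw [integral_add hi h1,
    integral_sub h2 (integrable_const _), integral_const_mul,
    integral_quadForm_sandwich_mul hB (t := 0) (by rw [trace_scaledHam hH, Complex.ofReal_zero]),
    integral_xhxField hH, integral_xhxField hH, effDOF_eq hH hs]
  simp
  field_simp
  ring

theorem integral_complexWishart {ι : Type*} [Fintype ι] (k : ℕ) {f : Matrix ι ι ℂ → ℝ}
    (hf : Measurable f) :
    ∫ J, f J ∂(complexWishart ι k) = ∫ G, f (G * Gᴴ) ∂(iidComplexNormal ι (Fin k)) := by
  rw [complexWishart, integral_map (measurable_mul_conjTranspose _ _).aemeasurable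
    hf.aestronglyMeasurable]

theorem integrable_complexWishart_iff {ι : Type*} [Fintype ι] (k : ℕ) {f : Matrix ι ι ℂ → ℝ}
    (hf : Measurable f) :
    Integrable f (complexWishart ι k) ↔
      Integrable (fun G => f (G * Gᴴ)) (iidComplexNormal ι (Fin k)) := by
  rw [complexWishart, integrable_map_measure hf.aestronglyMeasurable
    (measurable_mul_conjTranspose _ _).aemeasurable]
  rfl

theorem integrable_whrfField (r : ℕ) (ν : ℝ) (θ : Fin p → ℝ) (k : ℕ) :
    Integrable (whrfField r ν θ) (complexWishart _ k) := by
  rw [integrable_complexWishart_iff k (measurable_whrfField r ν θ)]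
  have h := (integrable_quadForm_sandwich (κ := Fin k) isHermitian_one
    (torusTensor r θ)).const_mul ν⁻¹
  simp only [Matrix.mul_one] at h
  exact h

theorem integral_whrfField (r : ℕ) (ν : ℝ) (θ : Fin p → ℝ) (k : ℕ) :
    ∫ J, whrfField r ν θ J ∂(complexWishart _ k) = ν⁻¹ * k := by
  rw [integral_complexWishart k (measurable_whrfField r ν θ)]
  have h := integral_quadForm_sandwich (κ := Fin k) isHermitian_one (torusTensor r θ)
  simp only [Matrix.mul_one] at h
  unfold whrfField
  rw [integral_const_mul, h, sum_torusTensor_sq]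
  simp

theorem whrfField_mul (r : ℕ) (ν : ℝ) (θ θ' : Fin p → ℝ)
    (J : Matrix (Fin r → Fin p → Fin 2) (Fin r → Fin p → Fin 2) ℂ) :
    whrfField r ν θ J * whrfField r ν θ' J =
      ν⁻¹ ^ 2 * (quadForm J (torusTensor r θ) * quadForm J (torusTensor r θ')) := by
  unfold whrfField
  ring

theorem measurable_whrfField_mul (r : ℕ) (ν : ℝ) (θ θ' : Fin p → ℝ) :
    Measurable fun J => whrfField r ν θ J * whrfField r ν θ' J :=
  (measurable_whrfField r ν θ).mul (measurable_whrfField r ν θ')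

theorem integrable_whrfField_mul (r : ℕ) (ν : ℝ) (θ θ' : Fin p → ℝ) (k : ℕ) :
    Integrable (fun J => whrfField r ν θ J * whrfField r ν θ' J) (complexWishart _ k) := by
  rw [integrable_complexWishart_iff k (measurable_whrfField_mul r ν θ θ')]
  have h := (integrable_quadForm_sandwich_mul (κ := Fin k) isHermitian_one
    (torusTensor r θ) (torusTensor r θ')).const_mul (ν⁻¹ ^ 2)
  simpa only [Matrix.mul_one, whrfField_mul] using h

theorem integral_whrfField_mul (r : ℕ) (ν : ℝ) (θ θ' : Fin p → ℝ) (k : ℕ) :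
    ∫ J, whrfField r ν θ J * whrfField r ν θ' J ∂(complexWishart _ k) =
      ν⁻¹ ^ 2 * ((k : ℝ) ^ 2 + (∑ i, torusTensor r θ i * torusTensor r θ' i) ^ 2 * k) := by
  rw [integral_complexWishart k (measurable_whrfField_mul r ν θ θ')]
  have h := integral_quadForm_sandwich_mul (κ := Fin k) isHermitian_one (t := k) (by simp)
    (torusTensor r θ) (torusTensor r θ')
  simp only [Matrix.mul_one] at h
  have h1 : ∑ a : Fin k, ∑ b : Fin k, ‖(1 : Matrix (Fin k) (Fin k) ℂ) a b‖ ^ 2 = k := by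
    simp [one_apply, apply_ite]
  simp_rw [whrfField_mul]
  rw [integral_const_mul, h, sum_torusTensor_sq, sum_torusTensor_sq, h1]
  ring

open Polynomial in
theorem hasWishartExpectation_whrfField (r : ℕ) {ν : ℝ} (hν : ν ≠ 0) (θ : Fin p → ℝ) :
    HasWishartExpectation ν (whrfField r ν θ) 1 := by
  refine ⟨C ν⁻¹ * X, fun k _ => ⟨integrable_whrfField r ν θ k, ?_⟩, ?_⟩
  · rw [integral_whrfField]
    simp
  · simp [hν]

open Polynomial in
-- The normalisation `ν⁻¹` stays fixed while the degrees of freedom `k` vary, so the moment is a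
-- polynomial in `k`; only then is `k = ν` substituted.
theorem hasWishartExpectation_whrfField_mul (r : ℕ) {ν : ℝ} (hν : ν ≠ 0) (θ θ' : Fin p → ℝ) :
    HasWishartExpectation ν (fun J => whrfField r ν θ J * whrfField r ν θ' J)
      (1 + (∑ i, torusTensor r θ i * torusTensor r θ' i) ^ 2 / ν) := by
  refine ⟨C (ν⁻¹ ^ 2) * (X ^ 2 + C ((∑ i, torusTensor r θ i * torusTensor r θ' i) ^ 2) * X),
    fun k _ => ⟨integrable_whrfField_mul r ν θ θ' k, ?_⟩, ?_⟩
  · rw [integral_whrfField_mul]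
    simp only [eval_mul, eval_add, eval_C, eval_X, eval_pow]
  · simp only [eval_mul, eval_add, eval_C, eval_X, eval_pow]
    field_simp

theorem natCast_bounds_of_abs_sub_le {m : ℝ} (hm : 1 < m) {k : ℕ} (hk : |(k : ℝ) - m| ≤ 1 / 2) :
    1 ≤ k ∧ m / 2 ≤ k := by
  have h := (abs_le.mp hk).1
  have hk0 : (0 : ℝ) < k := by linarith
  exact ⟨by exact_mod_cast hk0, by linarith⟩

theorem abs_integral_whrfField_mul_sub_le (r : ℕ) {m : ℝ} (hm : 1 < m) (θ θ' : Fin p → ℝ) {k : ℕ}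
    (hk : |(k : ℝ) - m| ≤ 1 / 2) :
    |∫ J, whrfField r (k : ℝ) θ J * whrfField r (k : ℝ) θ' J ∂(complexWishart _ k) -
      (1 + (∑ i, torusTensor r θ i * torusTensor r θ' i) ^ 2 / m)| ≤ 2 * |(k : ℝ) - m| / m ^ 2 := by
  obtain ⟨h1, h2⟩ := natCast_bounds_of_abs_sub_le hm hk
  have hk0 : (0 : ℝ) < k := by exact_mod_cast h1
  have hm0 : 0 < m := by linarith
  have hcs := Finset.sum_mul_sq_le_sq_mul_sq Finset.univ (torusTensor r θ) (torusTensor r θ')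
  rw [sum_torusTensor_sq, sum_torusTensor_sq, one_mul] at hcs
  rw [integral_whrfField_mul]
  set ρ := (∑ i, torusTensor r θ i * torusTensor r θ' i) ^ 2
  have hρ : 0 ≤ ρ := sq_nonneg _
  -- The error is `ρ (1/k - 1/m)`, with `ρ ≤ 1` by Cauchy–Schwarz; `k ≥ m/2` then produces the
  -- factor 2.
  have he : (k : ℝ)⁻¹ ^ 2 * ((k : ℝ) ^ 2 + ρ * k) - (1 + ρ / m) =
      ρ / (k * m) * -((k : ℝ) - m) := by
    field_simp
    ring
  rw [he, abs_mul, abs_neg, abs_of_nonneg (by positivity), mul_div_right_comm]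
  refine mul_le_mul_of_nonneg_right ?_ (abs_nonneg _)
  rw [div_le_div_iff₀ (by positivity) (by positivity)]
  nlinarith [mul_le_mul_of_nonneg_right hcs (sq_nonneg m)]

/-! ### The law of the XHX field at a point -/

theorem measurable_xhxField (r : ℕ) (H : Matrix (Fin (2 ^ n)) (Fin (2 ^ n)) ℂ) (θ : Fin p → ℝ) :
    Measurable (xhxField r H θ) := by
  refine (((measurable_quadForm _).comp (measurable_matrix_of_apply fun i j => ?_)).const_mul
    _).add_const _
  simp only [mul_apply, conjTranspose_apply]
  exact Finset.measurable_sum _ fun l _ => (Finset.measurable_sum _ fun a _ =>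
    (measurable_matrix_apply i a).mul_const _).mul
    (continuous_star.measurable.comp (measurable_matrix_apply j l))

instance isProbabilityMeasure_xhxLaw (r : ℕ) (H : Matrix (Fin (2 ^ n)) (Fin (2 ^ n)) ℂ)
    (θ : Fin p → ℝ) : IsProbabilityMeasure (xhxLaw r H θ) :=
  Measure.isProbabilityMeasure_map (measurable_xhxField r H θ).aemeasurable

theorem xhxField_sub_one_sq (r : ℕ) (θ : Fin p → ℝ)
    (X : Matrix (Fin r → Fin p → Fin 2) (Fin (2 ^ n)) ℂ) :
    (xhxField r H θ X - 1) ^ 2 =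
      (xhxField r H θ X * xhxField r H θ X - 2 * xhxField r H θ X) + 1 := by
  ring

theorem integrable_sub_one_sq_xhxLaw (hH : H.IsHermitian) (r : ℕ) (θ : Fin p → ℝ) :
    Integrable (fun x => (x - 1) ^ 2) (xhxLaw r H θ) := by
  rw [xhxLaw, integrable_map_measure (by fun_prop) (measurable_xhxField r H θ).aemeasurable]
  simp only [Function.comp_def, xhxField_sub_one_sq]
  exact ((integrable_xhxField_mul hH r θ θ).sub ((integrable_xhxField hH r θ).const_mul 2)).add
    (integrable_const _)

theorem integral_sub_one_sq_xhxLaw (hH : H.IsHermitian)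
    (hs : ∀ a : ℝ, H ≠ (a : ℂ) • (1 : Matrix (Fin (2 ^ n)) (Fin (2 ^ n)) ℂ))
    (r : ℕ) (θ : Fin p → ℝ) :
    ∫ x, (x - 1) ^ 2 ∂(xhxLaw r H θ) = (effDOF H)⁻¹ := by
  have h1 := integrable_xhxField hH r θ
  have h2 := integrable_xhxField_mul hH r θ θ
  rw [xhxLaw, integral_map (measurable_xhxField r H θ).aemeasurable (by fun_prop)]
  simp_rw [xhxField_sub_one_sq]
  refine (integral_add (h2.sub (h1.const_mul 2)) (integrable_const _)).trans ?_
  simp only [Pi.sub_apply]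
  rw [integral_sub h2
    (h1.const_mul 2), integral_const_mul, integral_xhxField hH, integral_xhxField_mul hH hs]
  simp_rw [← pow_two, sum_torusTensor_sq]
  simp
  ring

/-- Serves both `a = m` and `a = k`: the variance `1/a` is at most `2/m` as soon as `a ≥ m/2`. -/
theorem levyDist_xhxLaw_gammaMeasure_le (hH : H.IsHermitian)
    (hs : ∀ a : ℝ, H ≠ (a : ℂ) • (1 : Matrix (Fin (2 ^ n)) (Fin (2 ^ n)) ℂ))
    (hm : 64 ≤ effDOF H) (r : ℕ) (θ : Fin p → ℝ) {a : ℝ} (ha : effDOF H / 2 ≤ a) :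
    levyDist (xhxLaw r H θ) (gammaMeasure a a) ≤
      (2 : ℝ) ^ (-(1 / 6 * min (n : ℝ) (Real.logb 2 (effDOF H)))) := by
  have hm0 := effDOF_pos hH hs
  have ha0 : 0 < a := by linarith
  have := isProbabilityMeasure_gammaMeasure ha0 ha0
  refine (levyDist_le_of_integral_sub_one_sq_le hm0 (integrable_sub_one_sq_xhxLaw hH r θ) ?_
    (integrable_sub_one_sq_gammaMeasure ha0) ?_).trans (two_mul_rpow_le_two_rpow_min hm _)
  · rw [integral_sub_one_sq_xhxLaw hH hs, inv_eq_one_div]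
    gcongr
    norm_num
  · rw [integral_sub_one_sq_gammaMeasure ha0, inv_le_comm₀ ha0 (by positivity), inv_div]
    exact ha

end Fields

/-! ### Growth of `m` with `n`, and the conclusion -/

theorem exists_forall_le_effDOF {c : ℝ} (hc : c < 1) (M : ℝ) : ∃ N : ℕ, ∀ n : ℕ, N ≤ n →
    ∀ H : Matrix (Fin (2 ^ n)) (Fin (2 ^ n)) ℂ, H.IsHermitian →
      (∀ a : ℝ, H ≠ (a : ℂ) • (1 : Matrix (Fin (2 ^ n)) (Fin (2 ^ n)) ℂ)) →
      (∀ x ∈ spectrum ℝ (scaledHam H), x ≤ (2 : ℝ) ^ (c * (n : ℝ))) → M ≤ effDOF H := by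
  -- The estimate of `m` needs an eigenvalue bound of at least 1, so a negative `c` is weakened to
  -- 0.
  have hc' : 0 < 1 - max c 0 := sub_pos.mpr (max_lt hc one_pos)
  have ht : Filter.Tendsto (fun n : ℕ => (2 : ℝ) ^ ((1 - max c 0) * (n : ℝ)))
      Filter.atTop Filter.atTop :=
    (tendsto_rpow_atTop_of_base_gt_one 2 one_lt_two).comp
      (tendsto_natCast_atTop_atTop.const_mul_atTop hc')
  obtain ⟨N, hN⟩ := Filter.eventually_atTop.mp (ht.eventually_ge_atTop (2 * M))
  refine ⟨N, fun n hn H hH hs hmax => ?_⟩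
  have h := rpow_le_two_mul_effDOF hH hs (le_max_right c 0) fun x hx => (hmax x hx).trans
    (Real.rpow_le_rpow_of_exponent_le one_le_two
      (mul_le_mul_of_nonneg_right (le_max_left c 0) n.cast_nonneg))
  linarith [hN n hn]

theorem mainTheorem4 :
    -- (1) equality of the first two moments, at real degrees of freedom `m` and with `m` rounded
    (∀ (n p r : ℕ) (H : Matrix (Fin (2 ^ n)) (Fin (2 ^ n)) ℂ), H.IsHermitian →
      (∀ a : ℝ, H ≠ (a : ℂ) • (1 : Matrix (Fin (2 ^ n)) (Fin (2 ^ n)) ℂ)) →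
      ∀ θ θ' : Fin p → ℝ,
        Integrable (xhxField r H θ) (iidComplexNormal _ _) ∧
        Integrable (fun X => xhxField r H θ X * xhxField r H θ' X) (iidComplexNormal _ _) ∧
        HasWishartExpectation (effDOF H) (whrfField r (effDOF H) θ)
          (∫ X, xhxField r H θ X ∂(iidComplexNormal _ _)) ∧
        HasWishartExpectation (effDOF H)
          (fun J => whrfField r (effDOF H) θ J * whrfField r (effDOF H) θ' J)
          (∫ X, xhxField r H θ X * xhxField r H θ' X ∂(iidComplexNormal _ _)) ∧
        ∀ k : ℕ, |(k : ℝ) - effDOF H| ≤ 1 / 2 →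
          ∫ J, whrfField r (k : ℝ) θ J ∂(complexWishart _ k) =
            ∫ X, xhxField r H θ X ∂(iidComplexNormal _ _) ∧
          |∫ J, whrfField r (k : ℝ) θ J * whrfField r (k : ℝ) θ' J ∂(complexWishart _ k) -
            ∫ X, xhxField r H θ X * xhxField r H θ' X ∂(iidComplexNormal _ _)| ≤
              2 * |(k : ℝ) - effDOF H| / effDOF H ^ 2) ∧
    -- (2) the one-point law of the WHRF, which makes sense of real degrees of freedom
    (∀ (p r k : ℕ) (θ : Fin p → ℝ), 1 ≤ k → whrfLaw r k θ = whrfFormalLaw (k : ℝ)) ∧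
    -- (3) the bound in Lévy distance, at real degrees of freedom `m` and with `m` rounded
    (∀ c : ℝ, c < 1 → ∃ κ : ℝ, 0 < κ ∧ ∃ N : ℕ, ∀ n : ℕ, N ≤ n →
      ∀ H : Matrix (Fin (2 ^ n)) (Fin (2 ^ n)) ℂ, H.IsHermitian →
      (∀ a : ℝ, H ≠ (a : ℂ) • (1 : Matrix (Fin (2 ^ n)) (Fin (2 ^ n)) ℂ)) →
      (∀ x ∈ spectrum ℝ (scaledHam H), x ≤ (2 : ℝ) ^ (c * (n : ℝ))) →
      ∀ (p r : ℕ) (θ : Fin p → ℝ),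
        levyDist (xhxLaw r H θ) (whrfFormalLaw (effDOF H)) ≤
          (2 : ℝ) ^ (-(κ * min (n : ℝ) (Real.logb 2 (effDOF H)))) ∧
        ∀ k : ℕ, |(k : ℝ) - effDOF H| ≤ 1 / 2 →
          levyDist (xhxLaw r H θ) (whrfLaw r k θ) ≤
            (2 : ℝ) ^ (-(κ * min (n : ℝ) (Real.logb 2 (effDOF H))))) := by
  refine ⟨?_, fun p r k θ hk => whrfLaw_eq_gammaMeasure r hk θ, fun c hc => ?_⟩
  · intro n p r H hH hs θ θ'
    have hm := one_lt_effDOF hH hs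
    have hm0 := (effDOF_pos hH hs).ne'
    rw [integral_xhxField hH, integral_xhxField_mul hH hs]
    refine ⟨integrable_xhxField hH r θ, integrable_xhxField_mul hH r θ θ',
      hasWishartExpectation_whrfField r hm0 θ, hasWishartExpectation_whrfField_mul r hm0 θ θ',
      fun k hk => ⟨?_, abs_integral_whrfField_mul_sub_le r hm θ θ' hk⟩⟩
    have hk0 : (k : ℝ) ≠ 0 := by
      have := (natCast_bounds_of_abs_sub_le hm hk).1
      positivity
    rw [integral_whrfField, inv_mul_cancel₀ hk0]
  · obtain ⟨N, hN⟩ := exists_forall_le_effDOF hc 64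
    refine ⟨1 / 6, by norm_num, N, fun n hn H hH hs hmax p r θ => ?_⟩
    have hm := hN n hn H hH hs hmax
    refine ⟨levyDist_xhxLaw_gammaMeasure_le hH hs hm r θ (by linarith), fun k hk => ?_⟩
    obtain ⟨h1, h2⟩ := natCast_bounds_of_abs_sub_le (by linarith) hk
    rw [whrfLaw_eq_gammaMeasure r h1]
    exact levyDist_xhxLaw_gammaMeasure_le hH hs hm r θ h2
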